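/- Let $n\ge 1$ and write $(x,t)\in\mathbb R^n\times\mathbb R=\mathbb R^{n+1}$. For $z\in\mathbb C^n$ with $\operatorname{Im}z\ne0$ put $P_z(\xi,\eta)=-i\eta-2i\,z\cdot\xi+|\xi|^2$ for $(\xi,\eta)\in\mathbb R^n\times\mathbb R$, where $z\cdot\xi=\sum_j z_j\xi_j$. The function $1/P_z$ defines a tempered distribution on $\mathbb R^{n+1}$; let $G_z$ be its inverse Fourier transform, $$G_z(x,t)=\frac1{(2\pi)^{n+1}}\int e^{i x\cdot\xi+it\eta}\,\frac{d\xi\,d\eta}{P_z(\xi,\eta)} .$$ For $s\in\mathbb R$ let $L^2_s(\mathbb R^{n+1})$ be the space of tempered distributions $u$ with $(1+|x|^2+t^2)^{s/2}u\in L^2(\mathbb R^{n+1})$, with norm $\|u\|_s=\left(\int|u(x,t)|^2(1+|x|^2+t^2)^s\,dx\,dt\right)^{1/2}$, and for $R>0$ let $C(R)=\min\{R^4,R^2,1\}$. **Proposition.** Let $-1<\delta<0$. There is a constant $C_\delta>0$, depending only on $\delta$ and $n$, such that for all $R>0$, all $\tau\ge R$, all $\omega\in S^{n-1}$, all rapidly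 decreasing functions $g:\mathbb R^{n+1}\to\mathbb C$, and all multi-indices $\alpha\in\mathbb Z_{\ge0}^n$ and integers $\beta\ge0$ with $|\alpha|+2\beta\le2$, the tempered distribution $D_x^\alpha D_t^\beta(G_{i\tau\omega}*g)$ belongs to $L^2_\delta(\mathbb R^{n+1})$ and $$\|D_x^\alpha D_t^\beta(G_{i\tau\omega}*g)\|_\delta\le\frac{C_\delta\,\tau^{|\alpha|+2\beta}}{C(R)^{1/2}}\,\|g\|_{1+\delta}.$$ Here $D_x^\alpha D_t^\beta$ denotes the distributional partial derivative $\partial_x^\alpha\partial_t^\beta$. -/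

import Mathlib

open MeasureTheory SchwartzMap FourierTransform LineDeriv
open scoped ENNReal

/-- A complex-valued function is *tempered* if it is measurable and becomes integrable after
division by a power of `1 + ‖x‖`; this is what makes `φ ↦ ∫ f φ` a tempered distribution. -/
def IsTempered {E : Type*} [NormedAddCommGroup E] [MeasureSpace E] (f : E → ℂ) : Prop :=
  ∃ N : ℕ, Integrable (fun x => ((1 + ‖x‖) ^ N)⁻¹ • f x)

theorem IsTempered.bound {E : Type*} [NormedAddCommGroup E] [NormedSpace ℝ E] {f : E → ℂ} {N : ℕ}
    (φ : 𝓢(E, ℂ)) (x : E) : ‖f x * φ x‖ ≤ ‖((1 + ‖x‖) ^ N)⁻¹ • f x‖ *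
      (2 ^ N * ((Finset.Iic (N, 0)).sup (fun m => SchwartzMap.seminorm ℂ m.1 m.2)) φ) := by
  have h := SchwartzMap.one_add_le_sup_seminorm_apply (𝕜 := ℂ) (m := (N, 0)) (k := N) (n := 0)
    le_rfl le_rfl φ x
  simp only [norm_iteratedFDeriv_zero] at h
  have h1 : 0 < (1 + ‖x‖) ^ N := by positivity
  calc ‖f x * φ x‖ = ‖((1 + ‖x‖) ^ N)⁻¹ • f x‖ * ((1 + ‖x‖) ^ N * ‖φ x‖) := by
        rw [norm_smul, norm_mul, norm_inv, Real.norm_of_nonneg h1.le]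
        field_simp
    _ ≤ _ := by gcongr

section Tempered

variable {E : Type*} [NormedAddCommGroup E] [NormedSpace ℝ E] [MeasureSpace E] [BorelSpace E]

theorem IsTempered.integrable_mul {f : E → ℂ} (hf : IsTempered f) (φ : 𝓢(E, ℂ)) :
    Integrable (fun x => f x * φ x) := by
  obtain ⟨N, hN⟩ := hf
  have hm : AEStronglyMeasurable f := by
    have h : f = fun x => ((1 + ‖x‖) ^ N) • (((1 + ‖x‖) ^ N)⁻¹ • f x) := by
      funext x
      rw [smul_inv_smul₀ (by positivity)]
    rw [h]
    have hc : Continuous (fun x : E => (1 + ‖x‖) ^ N) := by fun_prop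
    exact hc.aestronglyMeasurable.smul hN.aestronglyMeasurable
  exact (hN.norm.mul_const _).mono' (hm.mul φ.continuous.aestronglyMeasurable)
    (Filter.Eventually.of_forall (IsTempered.bound φ))

/-- The tempered distribution `φ ↦ ∫ f φ` of a tempered function `f`. -/
noncomputable def IsTempered.toDistribution {f : E → ℂ} (hf : IsTempered f) : 𝓢'(E, ℂ) :=
  ContinuousLinearMap.toPointwiseConvergenceCLM ℂ (RingHom.id ℂ) 𝓢(E, ℂ) ℂ
    (SchwartzMap.mkCLMtoNormedSpace (fun φ => ∫ x, f x * φ x)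
      (fun φ ψ => by
        simp only [add_apply, mul_add]
        exact integral_add (hf.integrable_mul φ) (hf.integrable_mul ψ))
      (fun a φ => by
        simp only [smul_apply, smul_eq_mul, mul_left_comm _ a, RingHom.id_apply]
        exact integral_const_mul a _)
      (by
        obtain ⟨N, hN⟩ := hf
        refine ⟨Finset.Iic (N, 0), (∫ x, ‖((1 + ‖x‖) ^ N)⁻¹ • f x‖) * 2 ^ N, by positivity,
          fun φ => ?_⟩
        refine (norm_integral_le_of_norm_le (hN.norm.mul_const _)
          (Filter.Eventually.of_forall (IsTempered.bound φ))).trans_eq ?_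
        rw [integral_mul_const, mul_assoc]
        rfl))

theorem IsTempered.toDistribution_apply {f : E → ℂ} (hf : IsTempered f) (φ : 𝓢(E, ℂ)) :
    hf.toDistribution φ = ∫ x, f x * φ x := rfl

end Tempered

theorem integrableOn_abs_rpow :
    IntegrableOn (fun y : ℝ => |y| ^ (-(1 / 2) : ℝ)) (Set.Icc (-1) 1) := by
  have h1 : IntegrableOn (fun y : ℝ => |y| ^ (-(1 / 2) : ℝ)) (Set.Ioc 0 1) := by
    have := (intervalIntegral.intervalIntegrable_rpow' (a := 0) (b := 1) (r := -(1 / 2))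
      (by norm_num)).1
    exact this.congr_fun (fun x hx => by simp only [abs_of_pos hx.1]) measurableSet_Ioc
  have h2 : IntegrableOn (fun y : ℝ => |y| ^ (-(1 / 2) : ℝ)) (Set.Ico (-1) 0) := by
    have := h1.comp_neg
    simpa using this
  have h3 : IntegrableOn (fun y : ℝ => |y| ^ (-(1 / 2) : ℝ)) (Set.Icc 0 1) :=
    (integrableOn_Icc_iff_integrableOn_Ioc (by simp)).2 h1
  refine (h2.union h3).mono_set fun x hx => ?_
  rcases lt_or_ge x 0 with h | h
  · exact Or.inl ⟨hx.1, h⟩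
  · exact Or.inr ⟨h, hx.2⟩

/-- Away from its singularity, `|y| ^ (-1/2) ≤ 1`. -/
theorem abs_rpow_le (y w : ℝ) (hw0 : 0 ≤ w) (hw : w ≤ 1) : w * |y| ^ (-(1 / 2) : ℝ) ≤
    (Set.Icc (-1 : ℝ) 1).indicator (fun y => |y| ^ (-(1 / 2) : ℝ)) y + w := by
  by_cases hy : y ∈ Set.Icc (-1 : ℝ) 1
  · rw [Set.indicator_of_mem hy]
    have : 0 ≤ |y| ^ (-(1 / 2) : ℝ) := by positivity
    nlinarith
  · rw [Set.indicator_of_notMem hy, zero_add]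
    have h1 : 1 ≤ |y| := by
      by_contra h
      exact hy (abs_le.1 (not_le.1 h).le)
    have := Real.rpow_le_one_of_one_le_of_nonpos h1 (z := -(1 / 2)) (by norm_num)
    nlinarith

theorem exists_lintegral_bound : ∃ K : ℝ≥0∞, K ≠ ⊤ ∧ ∀ c : ℝ,
    ∫⁻ y : ℝ, ENNReal.ofReal ((1 + ‖y‖) ^ (-2 : ℝ) * |y + c| ^ (-(1 / 2) : ℝ)) ≤ K := by
  set u : ℝ → ℝ := (Set.Icc (-1 : ℝ) 1).indicator (fun y => |y| ^ (-(1 / 2) : ℝ))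
  have hu : Integrable u := integrableOn_abs_rpow.integrable_indicator measurableSet_Icc
  have hv : Integrable (fun y : ℝ => (1 + ‖y‖) ^ (-2 : ℝ)) :=
    integrable_one_add_norm (by simp)
  refine ⟨(∫⁻ y, ENNReal.ofReal (u y)) + ∫⁻ y : ℝ, ENNReal.ofReal ((1 + ‖y‖) ^ (-2 : ℝ)),
    ENNReal.add_ne_top.2 ⟨hu.lintegral_lt_top.ne, hv.lintegral_lt_top.ne⟩, fun c => ?_⟩
  rw [← lintegral_add_right_eq_self (fun y => ENNReal.ofReal (u y)) c, ← lintegral_add_right]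
  · refine lintegral_mono fun y => ?_
    rw [← ENNReal.ofReal_add (Set.indicator_nonneg (fun _ _ => by positivity) _) (by positivity)]
    refine ENNReal.ofReal_le_ofReal (abs_rpow_le (y + c) _ (by positivity) ?_)
    exact Real.rpow_le_one_of_one_le_of_nonpos (by simp) (by norm_num)
  · fun_prop

section Sphere

variable {E : Type*} [NormedAddCommGroup E] [InnerProductSpace ℝ E] [FiniteDimensional ℝ E]
  [MeasurableSpace E] [BorelSpace E]

theorem lintegral_sphere_lt_top {b : E} (hb : b ≠ 0) {r : ℝ} (hr : Module.finrank ℝ E < r) :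
    ∫⁻ x : E, ENNReal.ofReal ((1 + ‖x‖) ^ (-r) * |‖x + b‖ ^ 2 - ‖b‖ ^ 2| ^ (-(1 / 2) : ℝ)) < ⊤ := by
  have : Nontrivial E := ⟨b, 0, hb⟩
  have hρ : 0 < ‖b‖ := norm_pos_iff.2 hb
  have hr0 : 0 ≤ r := (Nat.cast_nonneg _).trans hr.le
  set u : ℝ → ℝ := (Set.Icc (-1 : ℝ) 1).indicator (fun y => |y| ^ (-(1 / 2) : ℝ)) with hu_def
  have hu : Integrable u := integrableOn_abs_rpow.integrable_indicator measurableSet_Icc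
  have hu' : Integrable (fun y => u (y - ‖b‖)) := hu.comp_sub_right _
  have hu0 : ∀ y, 0 ≤ u y := fun y => Set.indicator_nonneg (fun _ _ => by positivity) _
  have h1 : Integrable (fun x : E => u (‖x‖ - ‖b‖)) := by
    rw [integrable_fun_norm_addHaar (μ := volume) (f := fun y => u (y - ‖b‖))]
    refine Integrable.mono' (hu'.const_mul ((‖b‖ + 1) ^ (Module.finrank ℝ E - 1))).integrableOn
      ?_ ?_
    · have hc : Continuous (fun y : ℝ => y ^ (Module.finrank ℝ E - 1)) := by fun_prop
      exact (hc.aestronglyMeasurable.smul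
        hu'.aestronglyMeasurable).mono_measure Measure.restrict_le_self
    · filter_upwards [ae_restrict_mem measurableSet_Ioi] with y hy
      have hy : 0 < y := hy
      rw [norm_smul, Real.norm_of_nonneg (hu0 _), Real.norm_of_nonneg (by positivity)]
      by_cases h : y - ‖b‖ ∈ Set.Icc (-1 : ℝ) 1
      · have := hu0 (y - ‖b‖)
        have : y ≤ ‖b‖ + 1 := by linarith [h.2]
        gcongr
      · rw [hu_def, Set.indicator_of_notMem h]; simp
  have h2 : Integrable (fun x : E => u (‖x + b‖ - ‖b‖)) := h1.comp_add_right b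
  have h3 : Integrable (fun x : E => (1 + ‖x‖) ^ (-r)) := integrable_one_add_norm hr
  have h4 := ((h2.add h3).const_mul (‖b‖ ^ (-(1 / 2) : ℝ))).lintegral_lt_top
  refine lt_of_le_of_lt (lintegral_mono_ae ?_) h4
  have hs : ∀ᵐ x : E, x ∉ Metric.sphere (-b) ‖b‖ := by
    rw [ae_iff]
    have h := Measure.addHaar_sphere volume (-b) ‖b‖
    simpa only [not_not, Set.ofPred_mem_eq] using h
  filter_upwards [hs] with x hx
  have hx' : ‖x + b‖ - ‖b‖ ≠ 0 := by
    intro h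
    apply hx
    rw [mem_sphere_iff_norm, sub_neg_eq_add]
    linarith
  refine ENNReal.ofReal_le_ofReal ?_
  have hle : ‖b‖ * |‖x + b‖ - ‖b‖| ≤ |‖x + b‖ ^ 2 - ‖b‖ ^ 2| := by
    have : ‖x + b‖ ^ 2 - ‖b‖ ^ 2 = (‖x + b‖ + ‖b‖) * (‖x + b‖ - ‖b‖) := by ring
    rw [this, abs_mul, abs_of_nonneg (a := ‖x + b‖ + ‖b‖) (by positivity)]
    gcongr
    linarith [norm_nonneg (x + b)]
  have hpos : 0 < |‖x + b‖ - ‖b‖| := abs_pos.2 hx'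
  have key : |‖x + b‖ ^ 2 - ‖b‖ ^ 2| ^ (-(1 / 2) : ℝ) ≤
      ‖b‖ ^ (-(1 / 2) : ℝ) * |‖x + b‖ - ‖b‖| ^ (-(1 / 2) : ℝ) := by
    rw [← Real.mul_rpow hρ.le hpos.le]
    exact Real.rpow_le_rpow_of_nonpos (by positivity) hle (by norm_num)
  calc (1 + ‖x‖) ^ (-r) * |‖x + b‖ ^ 2 - ‖b‖ ^ 2| ^ (-(1 / 2) : ℝ)
      ≤ (1 + ‖x‖) ^ (-r) * (‖b‖ ^ (-(1 / 2) : ℝ) * |‖x + b‖ - ‖b‖| ^ (-(1 / 2) : ℝ)) := by gcongr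
    _ = ‖b‖ ^ (-(1 / 2) : ℝ) * ((1 + ‖x‖) ^ (-r) * |‖x + b‖ - ‖b‖| ^ (-(1 / 2) : ℝ)) := by ring
    _ ≤ ‖b‖ ^ (-(1 / 2) : ℝ) * (u (‖x + b‖ - ‖b‖) + (1 + ‖x‖) ^ (-r)) := by
        gcongr
        refine abs_rpow_le _ _ (by positivity) ?_
        exact Real.rpow_le_one_of_one_le_of_nonpos (by simp) (by linarith)

end Sphere

/-- Space-time `ℝⁿ × ℝ` with the Euclidean norm `(|x|² + t²)^{1/2}`; a point `p` has space part
`p.fst` and time part `p.snd`. -/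
abbrev SpaceTime (n : ℕ) := WithLp 2 (EuclideanSpace ℝ (Fin n) × ℝ)

/-- The symbol `P_z(ξ, η) = -iη - 2i z·ξ + |ξ|²` of `-∂_t - 2z·∇ - Δ`; the product `z·ξ` is
bilinear. -/
noncomputable def symbolP {n : ℕ} (z : Fin n → ℂ) (p : SpaceTime n) : ℂ :=
  -Complex.I * p.snd - 2 * Complex.I * ∑ j, z j * p.fst j + (‖p.fst‖ ^ 2 : ℝ)

theorem symbolP_re {n : ℕ} (z : Fin n → ℂ) (p : SpaceTime n) :
    (symbolP z p).re =
      ‖p.fst + WithLp.toLp 2 (fun j => (z j).im)‖ ^ 2 - ‖WithLp.toLp 2 (fun j => (z j).im)‖ ^ 2 := by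
  simp only [symbolP, EuclideanSpace.norm_sq_eq]
  simp [-Complex.ofReal_sum, -Complex.ofReal_pow, -Complex.ofReal_add, Complex.ofReal_re,
    Finset.mul_sum, ← Finset.sum_add_distrib, ← Finset.sum_sub_distrib]
  refine Finset.sum_congr rfl fun j _ => ?_
  ring

theorem symbolP_im {n : ℕ} (z : Fin n → ℂ) (p : SpaceTime n) :
    (symbolP z p).im = -(p.snd + 2 * ∑ j, (z j).re * p.fst j) := by
  simp only [symbolP]
  simp [Finset.mul_sum, -Complex.ofReal_pow]
  ring_nf

/-- `k ↦ 1 / P_z(2πk)` is tempered as soon as `Im z ≠ 0`. -/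
theorem isTempered_inv_symbolP {n : ℕ} {z : Fin n → ℂ} (hz : (fun j => (z j).im) ≠ 0) :
    IsTempered (fun k : SpaceTime n => 1 / symbolP z ((2 * Real.pi) • k)) := by
  set b : EuclideanSpace ℝ (Fin n) := WithLp.toLp 2 (fun j => (z j).im) with hb_def
  have hb : b ≠ 0 := by
    intro h
    exact hz ((WithLp.toLp_eq_zero 2).1 h)
  have hs : 1 ≤ 2 * Real.pi := by linarith [Real.two_le_pi]
  have hs0 : (2 * Real.pi) ≠ 0 := by positivity
  set s : ℝ := 2 * Real.pi
  set c : EuclideanSpace ℝ (Fin n) → ℝ := fun ξ => 2 * ∑ j, (z j).re * ξ j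
  have hb' : s⁻¹ • b ≠ 0 := smul_ne_zero (inv_ne_zero hs0) hb
  obtain ⟨K, hK, hKc⟩ := exists_lintegral_bound
  have hP : Continuous (symbolP z) := by
    unfold symbolP
    fun_prop
  have hm : Measurable (fun k : SpaceTime n => 1 / symbolP z (s • k)) :=
    measurable_const.div (hP.comp (continuous_const_smul s)).measurable
  have hbound : ∀ (ξ : EuclideanSpace ℝ (Fin n)) (η : ℝ),
      ‖ξ + s⁻¹ • b‖ ^ 2 - ‖s⁻¹ • b‖ ^ 2 ≠ 0 → η + c ξ ≠ 0 →
      ‖1 / symbolP z (s • (WithLp.toLp 2 (ξ, η) : SpaceTime n))‖ ≤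
        |‖ξ + s⁻¹ • b‖ ^ 2 - ‖s⁻¹ • b‖ ^ 2| ^ (-(1 / 2) : ℝ) * |η + c ξ| ^ (-(1 / 2) : ℝ) := by
    intro ξ η hA hB
    set A := ‖ξ + s⁻¹ • b‖ ^ 2 - ‖s⁻¹ • b‖ ^ 2 with hA_def
    set w := symbolP z (s • (WithLp.toLp 2 (ξ, η) : SpaceTime n)) with hw
    have hre : w.re = s ^ 2 * A := by
      rw [hw, symbolP_re, hA_def]
      have h1 : (s • (WithLp.toLp 2 (ξ, η) : SpaceTime n)).fst + b = s • (ξ + s⁻¹ • b) := by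
        rw [smul_add, smul_inv_smul₀ hs0]; rfl
      have h2 : b = s • s⁻¹ • b := (smul_inv_smul₀ hs0 b).symm
      have h3 : ‖b‖ = s * ‖s⁻¹ • b‖ := by
        conv_lhs => rw [h2]
        rw [norm_smul, Real.norm_of_nonneg (by positivity)]
      rw [h1, ← hb_def, h3, norm_smul s, Real.norm_of_nonneg (by positivity)]
      ring
    have him : w.im = -(s * (η + c ξ)) := by
      rw [hw, symbolP_im]
      simp only [c, WithLp.smul_fst, WithLp.smul_snd, PiLp.smul_apply, smul_eq_mul,
        Finset.mul_sum, mul_add]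
      congr 2
      refine Finset.sum_congr rfl fun j _ => ?_
      change 2 * ((z j).re * (s * ξ j)) = s * (2 * ((z j).re * ξ j))
      ring
    have hA1 : |A| ≤ ‖w‖ := by
      refine le_trans ?_ (Complex.abs_re_le_norm w)
      rw [hre, abs_mul, abs_of_nonneg (by positivity : 0 ≤ s ^ 2)]
      exact le_mul_of_one_le_left (abs_nonneg A) (one_le_pow₀ hs)
    have hB1 : |η + c ξ| ≤ ‖w‖ := by
      refine le_trans ?_ (Complex.abs_im_le_norm w)
      rw [him, abs_neg, abs_mul, abs_of_nonneg (by positivity : 0 ≤ s)]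
      exact le_mul_of_one_le_left (abs_nonneg _) hs
    have hA0 := abs_pos.2 hA
    have hB0 := abs_pos.2 hB
    have hw0 : 0 < ‖w‖ := hA0.trans_le hA1
    have e : ‖1 / w‖ = ‖w‖ ^ (-(1 / 2) : ℝ) * ‖w‖ ^ (-(1 / 2) : ℝ) := by
      rw [← Real.rpow_add hw0, norm_div, norm_one, one_div, ← Real.rpow_neg_one]
      norm_num
    rw [e]
    gcongr ?_ * ?_
    · exact Real.rpow_le_rpow_of_nonpos hA0 hA1 (by norm_num)
    · exact Real.rpow_le_rpow_of_nonpos hB0 hB1 (by norm_num)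
  have hw : Measurable (fun k : SpaceTime n => ((1 + ‖k‖) ^ (n + 1 + 2))⁻¹) := by fun_prop
  refine ⟨n + 1 + 2, ?_, ?_⟩
  · exact (hw.smul hm).aestronglyMeasurable
  rw [HasFiniteIntegral, ← (WithLp.volume_preserving_toLp (EuclideanSpace ℝ (Fin n))
    ℝ).lintegral_comp_emb (MeasurableEquiv.toLp 2 _).measurableEmbedding,
    MeasureTheory.Measure.volume_eq_prod, lintegral_prod]
  swap
  · refine Measurable.aemeasurable ?_
    have h1 : Measurable (fun k : SpaceTime n =>
        ‖((1 + ‖k‖) ^ (n + 1 + 2))⁻¹ • (1 / symbolP z (s • k))‖ₑ) := by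
      exact (hw.smul hm).enorm
    exact h1.comp (WithLp.measurable_toLp 2 _)
  have hfin := lintegral_sphere_lt_top hb' (r := (n + 1 : ℝ)) (by simp)
  refine lt_of_le_of_lt (b := ∫⁻ x : EuclideanSpace ℝ (Fin n),
    ENNReal.ofReal ((1 + ‖x‖) ^ (-(n + 1 : ℝ)) *
      |‖x + s⁻¹ • b‖ ^ 2 - ‖s⁻¹ • b‖ ^ 2| ^ (-(1 / 2) : ℝ)) * K) ?_ ?_
  swap
  · rw [lintegral_mul_const' _ _ hK]
    exact ENNReal.mul_lt_top hfin hK.lt_top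
  have : Nontrivial (EuclideanSpace ℝ (Fin n)) := ⟨b, 0, hb⟩
  have hsph : ∀ᵐ x : EuclideanSpace ℝ (Fin n), x ∉ Metric.sphere (-(s⁻¹ • b)) ‖s⁻¹ • b‖ := by
    rw [ae_iff]
    have h := Measure.addHaar_sphere volume (-(s⁻¹ • b)) ‖s⁻¹ • b‖
    simpa only [not_not, Set.ofPred_mem_eq] using h
  refine lintegral_mono_ae ?_
  filter_upwards [hsph] with ξ hξ
  have hA : ‖ξ + s⁻¹ • b‖ ^ 2 - ‖s⁻¹ • b‖ ^ 2 ≠ 0 := by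
    intro h
    apply hξ
    rw [mem_sphere_iff_norm, sub_neg_eq_add]
    exact (sq_eq_sq₀ (norm_nonneg _) (norm_nonneg _)).1 (sub_eq_zero.1 h)
  refine le_trans (b := ∫⁻ η : ℝ, ENNReal.ofReal ((1 + ‖ξ‖) ^ (-(n + 1 : ℝ)) *
      |‖ξ + s⁻¹ • b‖ ^ 2 - ‖s⁻¹ • b‖ ^ 2| ^ (-(1 / 2) : ℝ)) *
      ENNReal.ofReal ((1 + ‖η‖) ^ (-2 : ℝ) * |η + c ξ| ^ (-(1 / 2) : ℝ))) ?_ ?_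
  swap
  · rw [lintegral_const_mul' _ _ ENNReal.ofReal_ne_top]
    gcongr
    exact hKc _
  refine lintegral_mono_ae ?_
  have hne : ∀ᵐ η : ℝ, η ≠ -c ξ := Measure.ae_ne volume _
  filter_upwards [hne] with η hη
  have hB : η + c ξ ≠ 0 := fun h => hη (by linarith)
  rw [← ENNReal.ofReal_mul (by positivity), ← ofReal_norm]
  refine ENNReal.ofReal_le_ofReal ?_
  rw [norm_smul, mul_mul_mul_comm]
  refine mul_le_mul ?_ (hbound ξ η hA hB) (norm_nonneg _) (by positivity)
  have h1 : ‖ξ‖ ≤ ‖(WithLp.toLp 2 (ξ, η) : SpaceTime n)‖ :=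
    WithLp.norm_fst_le (x := WithLp.toLp 2 (ξ, η))
  have h2 : ‖η‖ ≤ ‖(WithLp.toLp 2 (ξ, η) : SpaceTime n)‖ :=
    WithLp.norm_snd_le (x := WithLp.toLp 2 (ξ, η))
  have e1 : (1 + ‖ξ‖) ^ (-(n + 1 : ℝ)) = ((1 + ‖ξ‖) ^ (n + 1))⁻¹ := by
    rw [Real.rpow_neg (by positivity)]; norm_cast
  have e2 : (1 + ‖η‖) ^ (-2 : ℝ) = ((1 + ‖η‖) ^ 2)⁻¹ := by
    rw [Real.rpow_neg (by positivity)]; norm_cast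
  rw [e1, e2, norm_inv, Real.norm_of_nonneg (by positivity), pow_add, mul_inv]
  gcongr

/-- The fundamental solution `G_z`, `Im z ≠ 0`: the inverse Fourier transform
`(2π)^{-(n+1)} ∫ e^{i x·ξ + i t η} / P_z(ξ, η) dξ dη`, as a tempered distribution. Mathlib's `𝓕⁻`
uses the kernel `e^{2πi ⟨x, k⟩}` without a prefactor, so with `(ξ, η) = 2πk` the formula above
becomes `𝓕⁻` of `k ↦ 1 / P_z(2πk)`. -/
noncomputable def fundSol {n : ℕ} (z : Fin n → ℂ) (hz : (fun j => (z j).im) ≠ 0) :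
    𝓢'(SpaceTime n, ℂ) :=
  𝓕⁻ (isTempered_inv_symbolP hz).toDistribution

/-- The vector `iτω ∈ ℂⁿ`. -/
noncomputable def imVec {n : ℕ} (τ : ℝ) (ω : EuclideanSpace ℝ (Fin n)) : Fin n → ℂ :=
  fun j => Complex.I * τ * ω j

theorem imVec_im_ne_zero {n : ℕ} {τ : ℝ} {ω : EuclideanSpace ℝ (Fin n)} (hτ : 0 < τ)
    (hω : ‖ω‖ = 1) : (fun j => (imVec τ ω j).im) ≠ 0 := by
  intro h
  have h0 : ω = 0 := by
    ext j
    have := congrFun h j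
    simpa [imVec, hτ.ne'] using this
  simp [h0] at hω

/-- The convolution `u * g` of a tempered distribution with a Schwartz function:
`⟨u * g, φ⟩ = ⟨u, ǧ * φ⟩` with `ǧ(x) = g(-x)`. -/
noncomputable def distConv {n : ℕ} (u : 𝓢'(SpaceTime n, ℂ)) (g : 𝓢(SpaceTime n, ℂ)) :
    𝓢'(SpaceTime n, ℂ) :=
  PointwiseConvergenceCLM.precomp ℂ
    (SchwartzMap.convolution (ContinuousLinearMap.mul ℂ ℂ)
      (SchwartzMap.compCLMOfContinuousLinearEquiv ℂ (ContinuousLinearEquiv.neg ℝ) g)) u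

/-- The unit vector of the `j`-th space coordinate. -/
noncomputable def spaceDir {n : ℕ} (j : Fin n) : SpaceTime n :=
  WithLp.toLp 2 (EuclideanSpace.single j 1, 0)

/-- The unit vector of the time coordinate. -/
noncomputable def timeDir (n : ℕ) : SpaceTime n := WithLp.toLp 2 (0, 1)

/-- The distributional derivative `D_x^α D_t^β u`, for a multi-index `α`. -/
noncomputable def mixedDeriv {n : ℕ} (α : Fin n → ℕ) (β : ℕ) (u : 𝓢'(SpaceTime n, ℂ)) :
    𝓢'(SpaceTime n, ℂ) :=
  (List.finRange n).foldr (fun j v => (fun w => ∂_{spaceDir j} w)^[α j] v)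
    ((fun w => ∂_{timeDir n} w)^[β] u)

/-- The weight `1 + |x|² + t²`. -/
noncomputable def weight {n : ℕ} (p : SpaceTime n) : ℝ := 1 + ‖p.fst‖ ^ 2 + p.snd ^ 2

/-- `‖f‖_s = (∫ |f(x,t)|² (1 + |x|² + t²)^s dx dt)^{1/2}`. -/
noncomputable def weightedNorm {n : ℕ} (s : ℝ) (f : SpaceTime n → ℂ) : ℝ :=
  (∫ p, ‖f p‖ ^ 2 * weight p ^ s) ^ (1 / 2 : ℝ)

/-- The tempered distribution `u` belongs to the weighted space `L²_s` and is given by the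
function `f` (which is then unique up to null sets). -/
def IsWeightedL2 {n : ℕ} (s : ℝ) (u : 𝓢'(SpaceTime n, ℂ)) (f : SpaceTime n → ℂ) : Prop :=
  AEStronglyMeasurable f ∧ Integrable (fun p => ‖f p‖ ^ 2 * weight p ^ s) ∧
    ∀ φ : 𝓢(SpaceTime n, ℂ), u φ = ∫ p, f p * φ p

/-- `C(R) = min {R⁴, R², 1}`. -/
noncomputable def scaleConst (R : ℝ) : ℝ := min (R ^ 4) (min (R ^ 2) 1)

/-! The proof is by duality. Tested against φ, the convolution becomes ∫ 𝓕g · 𝓕⁻φ / P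
(`distConv_fundSol_apply`), and derivatives insert monomials in (ξ, η) (`exists_mixedDeriv_apply`).
It suffices to bound this form by the norms of g in L²_{1+δ} and of φ in L²_{-δ}; the Riesz
representation then supplies the function (`exists_isWeightedL2`).

Put s = 1 + δ, so that 0 < s < 1 and 1 - s = -δ. Writing 1/|P| = |P|^{-s} |P|^{-(1-s)} and using
Cauchy–Schwarz reduces the form without monomials to ∫ |P|^{-2s} |𝓕f|² ≲ ‖f‖_s², for s and for 1 - s
(`exists_lintegral_symbol_rpow_le`). For z = iτω, Im P = -η and Re P = |ξ + τω|² - τ², and |P|^{-2s}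
≤ |Re P|^{-s} |Im P|^{-s}. Where |Re P| is not at least τ²/2, it is bounded below by a multiple of τ
|ξ_j - c_j|, with c_j independent of ξ_j and η. So |P|^{-2s} is dominated by a finite sum of
products of one-dimensional power singularities in orthogonal directions.

Such a singularity is handled by the fractional Hardy inequality on a line
(`lintegral_rpow_le_lintegral_difference`). Translations of 𝓕f are modulations of f, so its
difference energy turns into the weight |x·e|^s on the physical side, and one direction can be
treated after another (`exists_fourierWeightLE_mul`). Space and time together cost |x_j|^s |t|^s ≤
(1 + |x|² + t²)^s.

For derivatives, |ξ|² + |η| ≤ 3|P| + 4τ², so monomial/|P| is at most τ^{|α|+2β} (5/|P| + 3/τ²)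
(`norm_monomial_div_symbolP_le`); the last term needs only Plancherel. All negative powers of τ are
absorbed into m = C(R)^{-1/2}. -/

/-! ### Power integrals on the line -/

theorem lintegral_comp_mul_left_of_ne_zero (f : ℝ → ℝ≥0∞) {a : ℝ} (ha : a ≠ 0) :
    ∫⁻ u, f (a * u) = ‖a‖ₑ⁻¹ * ∫⁻ u, f u := by
  have h := lintegral_map_equiv (μ := (volume : Measure ℝ)) f (MeasurableEquiv.mulLeft₀ a ha)
  have h2 : Measure.map (MeasurableEquiv.mulLeft₀ a ha) volume
      = ENNReal.ofReal |a⁻¹| • (volume : Measure ℝ) := Real.map_volume_mul_left ha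
  rw [h2, lintegral_smul_measure] at h
  change _ = ∫⁻ u, f (a * u) at h
  rw [← h, ← Real.norm_eq_abs, ofReal_norm, enorm_inv ha, smul_eq_mul]

theorem lintegral_lt_top_of_even {f : ℝ → ℝ≥0∞} (hf : ∀ u, f (-u) = f u)
    (h : ∫⁻ u in Set.Ioi 0, f u < ⊤) : ∫⁻ u, f u < ⊤ := by
  have h1 : ∫⁻ u in Set.Iio 0, f u = ∫⁻ u in Set.Ioi 0, f u := by
    have := (Measure.measurePreserving_neg (volume : Measure ℝ)).setLIntegral_comp_preimage_emb
      (MeasurableEquiv.neg ℝ).measurableEmbedding f (Set.Iio 0)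
    rw [← this]
    simp [hf]
  rw [← lintegral_add_compl f (measurableSet_Ioi (a := (0 : ℝ))), Set.compl_Ioi,
    setLIntegral_congr Iio_ae_eq_Iic.symm, h1]
  exact ENNReal.add_lt_top.2 ⟨h, h⟩

theorem enorm_rpow_of_pos {u : ℝ} (hu : 0 < u) (a : ℝ) : ‖u‖ₑ ^ a = ENNReal.ofReal (u ^ a) := by
  rw [Real.enorm_of_nonneg hu.le, ENNReal.ofReal_rpow_of_pos hu]

/-- A function on the line is integrable if it is dominated by an integrable power near zero and
by an integrable power near infinity. -/
theorem lintegral_lt_top_of_rpow_bounds {G : ℝ → ℝ≥0∞} {K : ℝ≥0∞} (hK : K ≠ ⊤) {a b : ℝ}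
    (ha : -1 < a) (hb : b < -1) (h0 : ∀ u, u ≠ 0 → |u| ≤ 1 → G u ≤ K * ‖u‖ₑ ^ a)
    (h1 : ∀ u, 1 < |u| → G u ≤ K * ‖u‖ₑ ^ b) : ∫⁻ u, G u < ⊤ := by
  set B : ℝ → ℝ≥0∞ := fun u => if |u| ≤ 1 then ‖u‖ₑ ^ a else ‖u‖ₑ ^ b with hB
  have hBfin : ∫⁻ u, B u < ⊤ := by
    refine lintegral_lt_top_of_even (fun u => by simp [hB]) ?_
    rw [← Set.Ioc_union_Ioi_eq_Ioi (zero_le_one' ℝ)]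
    refine (lintegral_union_le _ _ _).trans_lt (ENNReal.add_lt_top.2 ⟨?_, ?_⟩)
    · have := (intervalIntegral.intervalIntegrable_rpow' (a := 0) (b := 1) ha).1.lintegral_lt_top
      refine lt_of_eq_of_lt (setLIntegral_congr_fun measurableSet_Ioc fun u hu => ?_) this
      simp only [hB]
      rw [if_pos (by rw [abs_of_pos hu.1]; exact hu.2), enorm_rpow_of_pos hu.1]
    · have := (integrableOn_Ioi_rpow_of_lt hb zero_lt_one).lintegral_lt_top
      refine lt_of_eq_of_lt (setLIntegral_congr_fun measurableSet_Ioi fun u hu => ?_) this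
      have hu : 1 < u := hu
      have hu0 : 0 < u := by linarith
      simp only [hB]
      rw [if_neg (by rw [abs_of_pos hu0]; linarith), enorm_rpow_of_pos hu0]
  refine lt_of_le_of_lt (lintegral_mono_ae (g := fun u => K * B u) ?_) ?_
  · filter_upwards [Measure.ae_ne volume 0] with u hu
    simp only [hB]
    split_ifs with h
    · exact h0 u hu h
    · exact h1 u (not_le.1 h)
  · rw [lintegral_const_mul' _ _ hK]
    exact ENNReal.mul_lt_top hK.lt_top hBfin

theorem enorm_rpow_mul_rpow {u : ℝ} (hu : u ≠ 0) (a b : ℝ) :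
    ‖u‖ₑ ^ a * ‖u‖ₑ ^ b = ‖u‖ₑ ^ (a + b) :=
  (ENNReal.rpow_add _ _ (by simpa using hu) (by simp)).symm

/-- Near zero the squared factor is O(h²), leaving the exponent 1 - s > -1; at infinity it is
bounded and -1 - s < -1. This integral is the constant that converts a difference energy of 𝓕f into
a power weight on f. -/
theorem lintegral_fourierChar_sub_one_lt_top {s : ℝ} (hs0 : 0 < s) (hs1 : s < 1) :
    ∫⁻ h : ℝ, ‖h‖ₑ ^ (-1 - s) * ‖(Real.fourierChar h : ℂ) - 1‖ₑ ^ 2 < ⊤ := by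
  refine lintegral_lt_top_of_rpow_bounds (K := ENNReal.ofReal ((2 * Real.pi) ^ 2))
    (a := -1 - s + 2) (b := -1 - s) ENNReal.ofReal_ne_top (by linarith) (by linarith) ?_ ?_
  · intro u hu _
    rw [← enorm_rpow_mul_rpow hu, mul_left_comm]
    gcongr
    rw [ENNReal.rpow_two, ENNReal.ofReal_pow (by positivity), ← mul_pow]
    gcongr
    rw [← ofReal_norm, ← ofReal_norm, ← ENNReal.ofReal_mul (by positivity)]
    refine ENNReal.ofReal_le_ofReal ?_
    rw [Real.fourierChar_apply, mul_comm _ Complex.I]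
    refine Real.norm_exp_I_mul_ofReal_sub_one_le.trans_eq ?_
    rw [norm_mul, Real.norm_of_nonneg (by positivity)]
  · intro u _
    rw [mul_comm]
    gcongr
    rw [ENNReal.ofReal_pow (by positivity)]
    gcongr
    rw [← ofReal_norm]
    refine ENNReal.ofReal_le_ofReal ((norm_sub_le _ _).trans ?_)
    rw [Circle.norm_coe, norm_one]
    linarith [Real.two_le_pi]

theorem lintegral_fourierChar_mul_sub_one_le (s y : ℝ) :
    ∫⁻ h : ℝ, ‖h‖ₑ ^ (-1 - s) * ‖(Real.fourierChar (h * y) : ℂ) - 1‖ₑ ^ 2 ≤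
      (∫⁻ h : ℝ, ‖h‖ₑ ^ (-1 - s) * ‖(Real.fourierChar h : ℂ) - 1‖ₑ ^ 2) * ‖y‖ₑ ^ s := by
  rcases eq_or_ne y 0 with rfl | hy
  · simp
  have h := lintegral_comp_mul_left_of_ne_zero
    (fun h : ℝ => ‖h‖ₑ ^ (-1 - s) * ‖(Real.fourierChar h : ℂ) - 1‖ₑ ^ 2) hy
  have hy0 : ‖y‖ₑ ≠ 0 := by simpa using hy
  have e : ∫⁻ h : ℝ, ‖h‖ₑ ^ (-1 - s) * ‖(Real.fourierChar h : ℂ) - 1‖ₑ ^ 2 =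
      ‖y‖ₑ * (‖y‖ₑ ^ (-1 - s) *
        ∫⁻ h : ℝ, ‖h‖ₑ ^ (-1 - s) * ‖(Real.fourierChar (h * y) : ℂ) - 1‖ₑ ^ 2) := by
    rw [← lintegral_const_mul']
    · simp_rw [← mul_assoc, ← ENNReal.mul_rpow_of_ne_top enorm_ne_top enorm_ne_top, ← enorm_mul]
      simp_rw [mul_comm _ y]
      rw [h, ← mul_assoc, ENNReal.mul_inv_cancel hy0 (by simp), one_mul]
    · exact ENNReal.rpow_ne_top_of_ne_zero hy0 (by simp)
  have e1 : ‖y‖ₑ ^ s * ‖y‖ₑ * ‖y‖ₑ ^ (-1 - s) = 1 := by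
    conv_lhs => enter [1, 2]; rw [← ENNReal.rpow_one ‖y‖ₑ]
    rw [enorm_rpow_mul_rpow hy, enorm_rpow_mul_rpow hy]
    ring_nf
    simp
  rw [e, mul_comm, ← mul_assoc, ← mul_assoc, e1, one_mul]

/-! ### Fractional Hardy inequality on the line -/

theorem enorm_sq_le_add {ε : ℝ} (hε : 0 < ε) (a b : ℂ) :
    ‖a‖ₑ ^ 2 ≤ ENNReal.ofReal (1 + ε) * ‖b‖ₑ ^ 2 + ENNReal.ofReal (1 + ε⁻¹) * ‖b - a‖ₑ ^ 2 := by
  simp only [← ofReal_norm]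
  rw [← ENNReal.ofReal_pow (norm_nonneg _), ← ENNReal.ofReal_pow (norm_nonneg _),
    ← ENNReal.ofReal_pow (norm_nonneg _), ← ENNReal.ofReal_mul (by positivity),
    ← ENNReal.ofReal_mul (by positivity), ← ENNReal.ofReal_add (by positivity) (by positivity)]
  refine ENNReal.ofReal_le_ofReal ?_
  have h1 : ‖a‖ ≤ ‖b‖ + ‖b - a‖ := by
    have := norm_sub_le b (b - a)
    simpa using this
  have h2 : ‖a‖ ^ 2 ≤ (‖b‖ + ‖b - a‖) ^ 2 := by gcongr
  have h3 : 0 ≤ ε⁻¹ * (ε * ‖b‖ - ‖b - a‖) ^ 2 := by positivity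
  have h4 : ε⁻¹ * (ε * ‖b‖ - ‖b - a‖) ^ 2 =
      ε * ‖b‖ ^ 2 - 2 * ‖b‖ * ‖b - a‖ + ε⁻¹ * ‖b - a‖ ^ 2 := by
    field_simp
    ring
  nlinarith

/-- Only finiteness matters here: it permits the absorption argument for the Hardy inequality, and M
does not enter the final constant. -/
theorem lintegral_enorm_sq_mul_rpow_lt_top {s : ℝ} (hs0 : 0 < s) (hs1 : s < 1) {F : ℝ → ℂ}
    (hF : ∃ M : ℝ, ∀ u, ‖F u‖ * (1 + |u|) ≤ M) : ∫⁻ u, ‖F u‖ₑ ^ 2 * ‖u‖ₑ ^ (-s) < ⊤ := by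
  obtain ⟨M, hM⟩ := hF
  have hM0 : 0 ≤ M := le_trans (by positivity) (hM 0)
  have h0 (u : ℝ) : ‖F u‖ ≤ M :=
    le_trans (le_mul_of_one_le_right (norm_nonneg _) (by linarith [abs_nonneg u])) (hM u)
  refine lintegral_lt_top_of_rpow_bounds (K := ENNReal.ofReal M ^ 2) (a := -s) (b := -2 + -s)
    (by finiteness) (by linarith) (by linarith) ?_ ?_
  · intro u _ _
    gcongr
    rw [← ofReal_norm]
    exact ENNReal.ofReal_le_ofReal (h0 u)
  · intro u hu
    have hu0 : u ≠ 0 := by rintro rfl; simp at hu; linarith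
    rw [← enorm_rpow_mul_rpow hu0, ← mul_assoc]
    gcongr
    rw [ENNReal.rpow_neg, ENNReal.rpow_two, ← div_eq_mul_inv,
      ENNReal.le_div_iff_mul_le (by simp [hu0]) (by simp), ← mul_pow]
    gcongr
    rw [← ofReal_norm, ← ofReal_norm, ← ENNReal.ofReal_mul (norm_nonneg _)]
    refine ENNReal.ofReal_le_ofReal (le_trans ?_ (hM u))
    gcongr
    rw [Real.norm_eq_abs]
    linarith

theorem lintegral_dilation {s : ℝ} (F : ℝ → ℂ) {a : ℝ} (ha : a ≠ 0) :
    ∫⁻ u, ‖F (a * u)‖ₑ ^ 2 * ‖u‖ₑ ^ (-s) =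
      ‖a‖ₑ ^ (s - 1) * ∫⁻ u, ‖F u‖ₑ ^ 2 * ‖u‖ₑ ^ (-s) := by
  have h := lintegral_comp_mul_left_of_ne_zero (fun u => ‖F u‖ₑ ^ 2 * ‖u‖ₑ ^ (-s)) ha
  have ha0 : ‖a‖ₑ ≠ 0 := by simpa using ha
  have e : ∀ u : ℝ, ‖F (a * u)‖ₑ ^ 2 * ‖u‖ₑ ^ (-s) =
      ‖a‖ₑ ^ s * (‖F (a * u)‖ₑ ^ 2 * ‖a * u‖ₑ ^ (-s)) := by
    intro u
    rw [enorm_mul, ENNReal.mul_rpow_of_ne_top enorm_ne_top enorm_ne_top,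
      mul_left_comm (‖F (a * u)‖ₑ ^ 2), ← mul_assoc, enorm_rpow_mul_rpow ha]
    simp
  simp_rw [e]
  rw [lintegral_const_mul' _ _ (ENNReal.rpow_ne_top_of_ne_zero ha0 (by simp)), h, ← mul_assoc,
    ← ENNReal.rpow_neg_one, enorm_rpow_mul_rpow ha]
  rfl

/-- Dilation by a multiplies the square of the norm of L²(|u|^{-s} du) by a^{s-1}, which is at most
2^{s-1} < 1 for a ≥ 2. Hence F ↦ F(a·) is a strict contraction, uniformly in a, and F is controlled
by F(a·) - F. -/
theorem lintegral_le_lintegral_dilation {s : ℝ} (hs0 : 0 < s) (hs1 : s < 1) :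
    ∃ C : ℝ≥0∞, C ≠ ⊤ ∧ ∀ F : ℝ → ℂ, Continuous F → (∃ M : ℝ, ∀ u, ‖F u‖ * (1 + |u|) ≤ M) →
      ∀ a : ℝ, 2 ≤ a → ∫⁻ u, ‖F u‖ₑ ^ 2 * ‖u‖ₑ ^ (-s) ≤
        C * ∫⁻ u, ‖F (a * u) - F u‖ₑ ^ 2 * ‖u‖ₑ ^ (-s) := by
  set p : ℝ := 2 ^ (s - 1) with hp
  have hp0 : 0 < p := by positivity
  have hp1 : p < 1 := Real.rpow_lt_one_of_one_lt_of_neg (by norm_num) (by linarith)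
  -- Any ε > 0 with (1 + ε) p < 1 would do; it leaves room to absorb the dilated term on the left.
  set ε : ℝ := (1 - p) / 2 with hεd
  have hε : 0 < ε := by rw [hεd]; linarith
  have hq : (1 + ε) * p < 1 := by rw [hεd]; nlinarith
  refine ⟨ENNReal.ofReal (1 - (1 + ε) * p)⁻¹ * ENNReal.ofReal (1 + ε⁻¹), by finiteness,
    fun F hFc hF a ha => ?_⟩
  have hfin := lintegral_enorm_sq_mul_rpow_lt_top hs0 hs1 hF
  set A := ∫⁻ u, ‖F u‖ₑ ^ 2 * ‖u‖ₑ ^ (-s)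
  set D := ∫⁻ u, ‖F (a * u) - F u‖ₑ ^ 2 * ‖u‖ₑ ^ (-s)
  have ha0 : 0 < a := by linarith
  have h1 : A ≤ ENNReal.ofReal ((1 + ε) * p) * A + ENNReal.ofReal (1 + ε⁻¹) * D := by
    calc A ≤ ∫⁻ u, (ENNReal.ofReal (1 + ε) * (‖F (a * u)‖ₑ ^ 2 * ‖u‖ₑ ^ (-s)) +
          ENNReal.ofReal (1 + ε⁻¹) * (‖F (a * u) - F u‖ₑ ^ 2 * ‖u‖ₑ ^ (-s))) := by
          refine lintegral_mono fun u => ?_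
          rw [← mul_assoc, ← mul_assoc, ← add_mul]
          gcongr
          exact enorm_sq_le_add hε _ _
      _ = ENNReal.ofReal (1 + ε) * (‖a‖ₑ ^ (s - 1) * A) + ENNReal.ofReal (1 + ε⁻¹) * D := by
          rw [lintegral_add_left (by fun_prop), lintegral_const_mul' _ _ (by finiteness),
            lintegral_const_mul' _ _ (by finiteness), lintegral_dilation F ha0.ne']
      _ ≤ _ := by
          rw [← mul_assoc, ENNReal.ofReal_mul (by positivity), enorm_rpow_of_pos ha0]
          gcongr
          exact Real.rpow_le_rpow_of_nonpos (by norm_num) ha (by linarith)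
  -- Subtracting the multiple of A is legitimate because A is finite.
  have h2 : ENNReal.ofReal (1 - (1 + ε) * p) * A ≤ ENNReal.ofReal (1 + ε⁻¹) * D := by
    rw [ENNReal.ofReal_sub _ (by positivity), ENNReal.sub_mul (fun _ _ => hfin.ne),
      ENNReal.ofReal_one, one_mul]
    exact tsub_le_iff_left.2 h1
  rw [mul_assoc, ENNReal.ofReal_inv_of_pos (by linarith)]
  rw [mul_comm] at h2
  rw [mul_comm, ← div_eq_mul_inv, ENNReal.le_div_iff_mul_le]
  · exact h2
  · left; simpa using hq
  · left; finiteness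

/-- The fractional Hardy inequality on the line below the critical exponent. -/
theorem lintegral_rpow_le_lintegral_difference {s : ℝ} (hs0 : 0 < s) (hs1 : s < 1) :
    ∃ C : ℝ≥0∞, C ≠ ⊤ ∧ ∀ F : ℝ → ℂ, Continuous F → (∃ M : ℝ, ∀ u, ‖F u‖ * (1 + |u|) ≤ M) →
      ∫⁻ u, ‖F u‖ₑ ^ 2 * ‖u‖ₑ ^ (-s) ≤
        C * ∫⁻ h, ‖h‖ₑ ^ (-1 - s) * ∫⁻ u, ‖F (u + h) - F u‖ₑ ^ 2 := by
  obtain ⟨C, hC, hCF⟩ := lintegral_le_lintegral_dilation hs0 hs1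
  -- The factor 2^(1+s) compensates for m^{-1-s} ≥ 2^{-1-s} on [1, 2].
  refine ⟨C * ENNReal.ofReal (2 ^ (1 + s)), by finiteness, fun F hFc hF => ?_⟩
  set A := ∫⁻ u, ‖F u‖ₑ ^ 2 * ‖u‖ₑ ^ (-s)
  -- The substitution h = u m turns dilation differences at u into translation differences.
  have hscale : ∀ u : ℝ, u ≠ 0 →
      (∫⁻ m, ‖m‖ₑ ^ (-1 - s) * ‖F (u + u * m) - F u‖ₑ ^ 2) * ‖u‖ₑ ^ (-s) =
        ∫⁻ h, ‖h‖ₑ ^ (-1 - s) * ‖F (u + h) - F u‖ₑ ^ 2 := by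
    intro u hu
    have h := lintegral_comp_mul_left_of_ne_zero
      (fun h => ‖h‖ₑ ^ (-1 - s) * ‖F (u + h) - F u‖ₑ ^ 2) hu
    have hu0 : ‖u‖ₑ ≠ 0 := by simpa using hu
    simp only [enorm_mul, ENNReal.mul_rpow_of_ne_top enorm_ne_top enorm_ne_top, mul_assoc] at h
    rw [lintegral_const_mul' _ _ (ENNReal.rpow_ne_top_of_ne_zero hu0 (by simp))] at h
    have h' := congrArg (fun x => ‖u‖ₑ * x) h
    simp only [← mul_assoc] at h'
    rw [ENNReal.mul_inv_cancel hu0 (by simp), one_mul] at h'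
    rw [← h', mul_comm]
    congr 1
    conv_rhs => enter [1]; rw [← ENNReal.rpow_one ‖u‖ₑ]
    rw [enorm_rpow_mul_rpow hu]
    ring_nf
  -- The dilation bound with a = 1 + m ≥ 2 is averaged over an interval of length one.
  have hA : A ≤ ∫⁻ m in Set.Icc (1 : ℝ) 2,
      C * ∫⁻ u, ‖F (u + u * m) - F u‖ₑ ^ 2 * ‖u‖ₑ ^ (-s) := by
    calc A = ∫⁻ _ in Set.Icc (1 : ℝ) 2, A := by simp; norm_num
      _ ≤ _ := by
        refine setLIntegral_mono' measurableSet_Icc fun m hm => ?_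
        refine (hCF F hFc hF (1 + m) (by linarith [hm.1])).trans_eq ?_
        congr! 8
        ring
  refine hA.trans ?_
  rw [lintegral_const_mul' _ _ hC, mul_assoc]
  gcongr
  rw [lintegral_lintegral_swap (by fun_prop)]
  have hswap : ∫⁻ h, ‖h‖ₑ ^ (-1 - s) * ∫⁻ u, ‖F (u + h) - F u‖ₑ ^ 2 =
      ∫⁻ u, ∫⁻ h, ‖h‖ₑ ^ (-1 - s) * ‖F (u + h) - F u‖ₑ ^ 2 := by
    rw [lintegral_lintegral_swap (by fun_prop)]
    refine lintegral_congr fun h => ?_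
    rw [lintegral_const_mul _ (by fun_prop)]
  rw [hswap, ← lintegral_const_mul' _ _ (by finiteness)]
  refine lintegral_mono_ae ?_
  filter_upwards [Measure.ae_ne volume 0] with u hu
  have hm : Measurable fun m => ‖F (u + u * m) - F u‖ₑ ^ 2 := by
    have : Continuous fun m => F (u + u * m) - F u := by fun_prop
    exact this.enorm.measurable.pow_const 2
  rw [← hscale u hu, ← mul_assoc, lintegral_mul_const _ hm]
  gcongr
  rw [← lintegral_const_mul' _ _ (by finiteness)]
  refine le_trans (setLIntegral_mono' measurableSet_Icc fun m hm => ?_)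
    (setLIntegral_le_lintegral (Set.Icc (1 : ℝ) 2) _)
  rw [← mul_assoc]
  refine le_mul_of_one_le_left (by positivity) ?_
  have hm0 : 0 < m := by linarith [hm.1]
  rw [enorm_rpow_of_pos hm0, ← ENNReal.ofReal_mul (by positivity), ENNReal.one_le_ofReal]
  have : (2 : ℝ) ^ (-1 - s) ≤ m ^ (-1 - s) :=
    Real.rpow_le_rpow_of_nonpos hm0 hm.2 (by linarith)
  calc (1 : ℝ) = 2 ^ (1 + s) * 2 ^ (-1 - s) := by
        rw [← Real.rpow_add (by norm_num)]; norm_num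
    _ ≤ _ := by gcongr

/-! ### From the line to a direction in a Euclidean space -/

theorem exists_decay_line {V : Type*} [NormedAddCommGroup V] [NormedSpace ℝ V]
    (F : 𝓢(V, ℂ)) {e : V} (he : ‖e‖ = 1) (y : V) :
    ∃ M : ℝ, ∀ u : ℝ, ‖F (y + u • e)‖ * (1 + |u|) ≤ M := by
  set M := 2 ^ 1 * ((Finset.Iic (1, 0)).sup (fun m => SchwartzMap.seminorm ℂ m.1 m.2)) F
  have h (x : V) : (1 + ‖x‖) ^ 1 * ‖F x‖ ≤ M := by
    have h := SchwartzMap.one_add_le_sup_seminorm_apply (𝕜 := ℂ) (m := (1, 0)) (k := 1) (n := 0)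
      le_rfl le_rfl F x
    simpa only [norm_iteratedFDeriv_zero] using h
  refine ⟨(1 + ‖y‖) * M, fun u => ?_⟩
  have h1 : |u| ≤ ‖y‖ + ‖y + u • e‖ := by
    have := norm_sub_le (y + u • e) y
    rw [add_sub_cancel_left, norm_smul, he, mul_one, Real.norm_eq_abs] at this
    linarith
  have h2 : 1 + |u| ≤ (1 + ‖y‖) * (1 + ‖y + u • e‖) := by
    nlinarith [norm_nonneg y, norm_nonneg (y + u • e)]
  calc ‖F (y + u • e)‖ * (1 + |u|) ≤
      ‖F (y + u • e)‖ * ((1 + ‖y‖) * (1 + ‖y + u • e‖)) := by gcongr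
    _ = (1 + ‖y‖) * ((1 + ‖y + u • e‖) ^ 1 * ‖F (y + u • e)‖) := by ring
    _ ≤ _ := by gcongr; exact h _

section Direction

variable {V : Type*} [NormedAddCommGroup V] [InnerProductSpace ℝ V] [FiniteDimensional ℝ V]
  [MeasurableSpace V] [BorelSpace V]

/-- Integration over the lines in the direction of a unit vector. -/
theorem lintegral_eq_lintegral_lines {e : V} (he : ‖e‖ = 1) {G : V → ℝ≥0∞} (hG : Measurable G) :
    ∫⁻ x, G x = ∫⁻ y, (Set.Icc (0 : ℝ) 1).indicator 1 (inner ℝ y e) * ∫⁻ u : ℝ, G (y + u • e) := by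
  have hκ : Measurable ((Set.Icc (0 : ℝ) 1).indicator (1 : ℝ → ℝ≥0∞)) :=
    measurable_one.indicator measurableSet_Icc
  have hi : Measurable fun y : V => inner ℝ y e := by fun_prop
  -- The slab 0 ≤ ⟨y, e⟩ ≤ 1 cuts every line parallel to e in a segment of length one. Tonelli and
  -- translation invariance therefore replace an orthogonal splitting of V.
  have h1 (y : V) : (Set.Icc (0 : ℝ) 1).indicator 1 (inner ℝ y e) * ∫⁻ u : ℝ, G (y + u • e) =
      ∫⁻ u : ℝ, (Set.Icc (0 : ℝ) 1).indicator 1 (inner ℝ y e) * G (y + u • e) := by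
    rw [lintegral_const_mul _ (by fun_prop)]
  have h2 (u : ℝ) : ∫⁻ y : V, (Set.Icc (0 : ℝ) 1).indicator 1 (inner ℝ y e) * G (y + u • e) =
      ∫⁻ y : V, (Set.Icc (0 : ℝ) 1).indicator 1 (inner ℝ y e - u) * G y := by
    rw [← lintegral_add_right_eq_self (fun y : V =>
      (Set.Icc (0 : ℝ) 1).indicator 1 (inner ℝ y e - u) * G y) (u • e)]
    simp [inner_add_left, inner_smul_left, he]
  simp_rw [h1]
  rw [lintegral_lintegral_swap (by fun_prop)]
  simp_rw [h2]
  rw [lintegral_lintegral_swap (by fun_prop)]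
  refine lintegral_congr fun y => ?_
  rw [lintegral_mul_const _ (by fun_prop), lintegral_sub_left_eq_self
    (fun t => (Set.Icc (0 : ℝ) 1).indicator (1 : ℝ → ℝ≥0∞) t) (inner ℝ y e)]
  simp

/-- The one-dimensional Hardy inequality holds on each line parallel to e. Invariance of c gives
each line a single singular point, and invariance of W makes the extra weight a constant factor
there. -/
theorem lintegral_rpow_le_lintegral_directional_difference {s : ℝ} (hs0 : 0 < s) (hs1 : s < 1) :
    ∃ C : ℝ≥0∞, C ≠ ⊤ ∧ ∀ (e : V) (c : V → ℝ) (W : V → ℝ≥0∞) (F : 𝓢(V, ℂ)), ‖e‖ = 1 →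
      Measurable c → (∀ x (u : ℝ), c (x + u • e) = c x) →
      Measurable W → (∀ x (u : ℝ), W (x + u • e) = W x) →
      ∫⁻ x, W x * ‖inner ℝ x e - c x‖ₑ ^ (-s) * ‖F x‖ₑ ^ 2 ≤
        C * ∫⁻ h : ℝ, ‖h‖ₑ ^ (-1 - s) * ∫⁻ x, W x * ‖F (x + h • e) - F x‖ₑ ^ 2 := by
  obtain ⟨C, hC, hCF⟩ := lintegral_rpow_le_lintegral_difference hs0 hs1
  refine ⟨C, hC, fun e c W F he hc hce hW hWe => ?_⟩
  have hFc := F.continuous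
  have hFm := hFc.measurable
  have hi : Measurable fun y : V => inner ℝ y e := by fun_prop
  have hdiff : Measurable fun p : V × ℝ => ‖F (p.1 + p.2 • e) - F p.1‖ₑ ^ 2 := by
    have : Continuous fun p : V × ℝ => F (p.1 + p.2 • e) - F p.1 := by fun_prop
    exact this.enorm.measurable.pow_const 2
  set H : V × ℝ → ℝ≥0∞ :=
    fun p => W p.1 * (‖p.2‖ₑ ^ (-1 - s) * ‖F (p.1 + p.2 • e) - F p.1‖ₑ ^ 2) with hH
  have hHm : Measurable H := by fun_prop
  have hRHS : ∫⁻ h : ℝ, ‖h‖ₑ ^ (-1 - s) * ∫⁻ x, W x * ‖F (x + h • e) - F x‖ₑ ^ 2 =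
      ∫⁻ x, ∫⁻ h : ℝ, H (x, h) := by
    rw [lintegral_lintegral_swap (by exact hHm.aemeasurable)]
    refine lintegral_congr fun h => ?_
    have hm : Measurable fun x => W x * ‖F (x + h • e) - F x‖ₑ ^ 2 :=
      hW.mul ((by fun_prop : Continuous fun x => F (x + h • e) - F x).enorm.measurable.pow_const 2)
    rw [← lintegral_const_mul _ hm]
    refine lintegral_congr fun x => ?_
    simp only [hH]
    ring
  rw [hRHS, ← lintegral_const_mul' _ _ hC, lintegral_eq_lintegral_lines he (by fun_prop),
    lintegral_eq_lintegral_lines he (hHm.lintegral_prod_right.const_mul C)]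
  refine lintegral_mono fun y => mul_le_mul' le_rfl ?_
  -- Shifting the parameter by d puts the singular point of the line at v = 0.
  set d := c y - inner ℝ y e with hd
  have hmain := hCF (fun v => F (y + (v + d) • e)) (by fun_prop) (by
    obtain ⟨M, hM⟩ := exists_decay_line F he (y + d • e)
    refine ⟨M, fun u => ?_⟩
    have := hM u
    rwa [add_assoc, ← add_smul, add_comm d] at this)
  have hL : ∫⁻ u : ℝ, W (y + u • e) * ‖inner ℝ (y + u • e) e - c (y + u • e)‖ₑ ^ (-s) *
      ‖F (y + u • e)‖ₑ ^ 2 = W y * ∫⁻ v, ‖F (y + (v + d) • e)‖ₑ ^ 2 * ‖v‖ₑ ^ (-s) := by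
    rw [← lintegral_add_right_eq_self _ d, ← lintegral_const_mul _ (by fun_prop)]
    refine lintegral_congr fun v => ?_
    rw [hWe, hce, inner_add_left, inner_smul_left, real_inner_self_eq_norm_sq, he]
    have : inner ℝ y e + (v + d) * 1 ^ 2 - c y = v := by rw [hd]; ring
    simp only [conj_trivial]
    rw [this]
    ring
  have hR : ∫⁻ u : ℝ, C * ∫⁻ h, H (y + u • e, h) = W y * (C * ∫⁻ h, ‖h‖ₑ ^ (-1 - s) *
      ∫⁻ v, ‖F (y + (v + h + d) • e) - F (y + (v + d) • e)‖ₑ ^ 2) := by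
    have hm1 : Measurable fun p : ℝ × ℝ => H (y + p.1 • e, p.2) := by fun_prop
    rw [lintegral_const_mul _ hm1.lintegral_prod_right,
      lintegral_lintegral_swap (by exact hm1.aemeasurable), mul_left_comm]
    congr 1
    have hm2 : Measurable fun p : ℝ × ℝ =>
        ‖F (y + (p.2 + p.1 + d) • e) - F (y + (p.2 + d) • e)‖ₑ ^ 2 := by
      have : Continuous fun p : ℝ × ℝ =>
        F (y + (p.2 + p.1 + d) • e) - F (y + (p.2 + d) • e) := by fun_prop
      exact this.enorm.measurable.pow_const 2
    rw [← lintegral_const_mul _ (by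
      have := hm2.lintegral_prod_right' (ν := volume)
      fun_prop)]
    refine lintegral_congr fun h => ?_
    rw [← lintegral_add_right_eq_self _ d]
    have hm3 : Measurable fun v : ℝ => ‖F (y + (v + h + d) • e) - F (y + (v + d) • e)‖ₑ ^ 2 :=
      (by fun_prop : Continuous fun v : ℝ =>
        F (y + (v + h + d) • e) - F (y + (v + d) • e)).enorm.measurable.pow_const 2
    simp only [hH, hWe]
    rw [← lintegral_const_mul _ hm3, ← lintegral_const_mul _ (by exact hm3.const_mul _)]
    refine lintegral_congr fun v => ?_
    have : y + (v + d) • e + h • e = y + (v + h + d) • e := by module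
    rw [this]
  rw [hL, hR]
  gcongr

end Direction

/-! ### Weighted Fourier inequalities -/

section Weights

variable {V : Type*} [NormedAddCommGroup V] [InnerProductSpace ℝ V] [FiniteDimensional ℝ V]
  [MeasurableSpace V] [BorelSpace V]

/-- The weighted inequality `∫ W |𝓕 f|² ≤ ∫ U |f|²` for all Schwartz functions `f`. -/
def FourierWeightLE (W U : V → ℝ≥0∞) : Prop :=
  ∀ f : 𝓢(V, ℂ), ∫⁻ x, W x * ‖𝓕 f x‖ₑ ^ 2 ≤ ∫⁻ x, U x * ‖f x‖ₑ ^ 2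

theorem lintegral_enorm_sq_fourier (f : 𝓢(V, ℂ)) :
    ∫⁻ x, ‖𝓕 f x‖ₑ ^ 2 = ∫⁻ x, ‖f x‖ₑ ^ 2 := by
  have h (g : 𝓢(V, ℂ)) : ∫⁻ x, ‖g x‖ₑ ^ 2 = ENNReal.ofReal (∫ x, ‖g x‖ ^ 2) := by
    rw [ofReal_integral_eq_lintegral_ofReal]
    · refine lintegral_congr fun x => ?_
      rw [ENNReal.ofReal_pow (norm_nonneg _), ofReal_norm]
    · exact (g.memLp 2 volume).integrable_norm_pow (by norm_num)
    · exact Filter.Eventually.of_forall fun x => by positivity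
  rw [h, h, integral_norm_sq_fourier]

theorem fourierWeightLE_one : FourierWeightLE (V := V) (fun _ => 1) (fun _ => 1) := fun f => by
  simp only [one_mul]
  exact (lintegral_enorm_sq_fourier f).le

theorem fourierInv_compSubConst (F : 𝓢(V, ℂ)) (v x : V) :
    𝓕⁻ (compSubConstCLM ℂ (-v) F) x = Real.fourierChar (-inner ℝ x v) * 𝓕⁻ F x := by
  rw [fourierInv_coe, fourierInv_coe, Real.fourierInv_eq, Real.fourierInv_eq, ← integral_const_mul,
    ← integral_add_right_eq_self _ (-v)]
  refine integral_congr_ae (Filter.Eventually.of_forall fun w => ?_)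
  simp only [compSubConstCLM_apply, sub_neg_eq_add, neg_add_cancel_right, Circle.smul_def,
    smul_eq_mul]
  rw [← mul_assoc, ← Circle.coe_mul, ← AddChar.map_add_eq_mul, inner_add_left, inner_neg_left,
    real_inner_comm v x, add_comm]

/-- A Hardy weight on the Fourier side costs a power weight on the physical side. -/
theorem exists_fourierWeightLE_mul {s : ℝ} (hs0 : 0 < s) (hs1 : s < 1) :
    ∃ C : ℝ≥0∞, C ≠ ⊤ ∧ ∀ (e : V) (c : V → ℝ) (W U : V → ℝ≥0∞), ‖e‖ = 1 →
      Measurable c → (∀ x (u : ℝ), c (x + u • e) = c x) →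
      Measurable W → (∀ x (u : ℝ), W (x + u • e) = W x) → Measurable U →
      FourierWeightLE W U →
      FourierWeightLE (fun x => W x * ‖inner ℝ x e - c x‖ₑ ^ (-s))
        (fun x => C * (U x * ‖inner ℝ x e‖ₑ ^ s)) := by
  obtain ⟨C, hC, hCF⟩ := lintegral_rpow_le_lintegral_directional_difference (V := V) hs0 hs1
  set K := ∫⁻ h : ℝ, ‖h‖ₑ ^ (-1 - s) * ‖(Real.fourierChar h : ℂ) - 1‖ₑ ^ 2 with hK
  refine ⟨C * K, ENNReal.mul_ne_top hC (lintegral_fourierChar_sub_one_lt_top hs0 hs1).ne,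
    fun e c W U he hc hce hW hWe hU hWU f => ?_⟩
  refine (hCF e c W (𝓕 f) he hc hce hW hWe).trans ?_
  have hi : Measurable fun y : V => inner ℝ y e := by fun_prop
  have hfc := f.continuous
  have hfm := hfc.measurable
  have hstep (h : ℝ) : ∫⁻ x, W x * ‖𝓕 f (x + h • e) - 𝓕 f x‖ₑ ^ 2 ≤
      ∫⁻ x, U x * (‖(Real.fourierChar (h * -inner ℝ x e) : ℂ) - 1‖ₑ ^ 2 * ‖f x‖ₑ ^ 2) := by
    -- G is the Fourier transform of f multiplied by a character minus one, so the hypothesis on W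
    -- and U applied to 𝓕⁻ G bounds the difference energy at step h.
    set G : 𝓢(V, ℂ) := compSubConstCLM ℂ (-(h • e)) (𝓕 f) - 𝓕 f with hG
    have h1 := hWU (𝓕⁻ G)
    rw [FourierTransform.fourier_fourierInv_eq] at h1
    have h2 (x : V) : G x = 𝓕 f (x + h • e) - 𝓕 f x := by
      simp [hG]
    have h3 (x : V) : 𝓕⁻ G x = ((Real.fourierChar (h * -inner ℝ x e) : ℂ) - 1) * f x := by
      have : 𝓕⁻ G = 𝓕⁻ (compSubConstCLM ℂ (-(h • e)) (𝓕 f)) - 𝓕⁻ (𝓕 f) := by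
        rw [hG]
        exact map_sub (fourierInvCLM ℂ 𝓢(V, ℂ)) _ _
      rw [this, sub_apply, fourierInv_compSubConst,
        FourierTransform.fourierInv_fourier_eq, inner_smul_right]
      ring_nf
    simp_rw [h2, h3, enorm_mul, mul_pow] at h1
    exact h1
  simp only [mul_assoc]
  rw [lintegral_const_mul' _ _ hC]
  gcongr
  calc ∫⁻ h : ℝ, ‖h‖ₑ ^ (-1 - s) * ∫⁻ x, W x * ‖𝓕 f (x + h • e) - 𝓕 f x‖ₑ ^ 2
      ≤ ∫⁻ h : ℝ, ∫⁻ x, ‖h‖ₑ ^ (-1 - s) *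
        (U x * (‖(Real.fourierChar (h * -inner ℝ x e) : ℂ) - 1‖ₑ ^ 2 * ‖f x‖ₑ ^ 2)) := by
        refine lintegral_mono fun h => ?_
        have hm : Measurable fun x =>
            U x * (‖(Real.fourierChar (h * -inner ℝ x e) : ℂ) - 1‖ₑ ^ 2 * ‖f x‖ₑ ^ 2) := by
          have : Measurable fun x =>
              ‖(Real.fourierChar (h * -inner ℝ x e) : ℂ) - 1‖ₑ ^ 2 :=
            (by fun_prop : Continuous fun x : V =>
              (Real.fourierChar (h * -inner ℝ x e) : ℂ) - 1).enorm.measurable.pow_const 2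
          fun_prop
        rw [lintegral_const_mul _ hm]
        exact mul_le_mul' le_rfl (hstep h)
    _ = ∫⁻ x, ∫⁻ h : ℝ, ‖h‖ₑ ^ (-1 - s) *
        (U x * (‖(Real.fourierChar (h * -inner ℝ x e) : ℂ) - 1‖ₑ ^ 2 * ‖f x‖ₑ ^ 2)) := by
        rw [lintegral_lintegral_swap]
        have : Measurable fun p : ℝ × V =>
            ‖(Real.fourierChar (p.1 * -inner ℝ p.2 e) : ℂ) - 1‖ₑ ^ 2 :=
          (by fun_prop : Continuous fun p : ℝ × V =>
            (Real.fourierChar (p.1 * -inner ℝ p.2 e) : ℂ) - 1).enorm.measurable.pow_const 2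
        fun_prop
    _ ≤ ∫⁻ x, K * (U x * (‖inner ℝ x e‖ₑ ^ s * ‖f x‖ₑ ^ 2)) := by
        refine lintegral_mono fun x => ?_
        have hm : Measurable fun h : ℝ => ‖h‖ₑ ^ (-1 - s) *
            ‖(Real.fourierChar (h * -inner ℝ x e) : ℂ) - 1‖ₑ ^ 2 := by
          have := (by fun_prop : Continuous fun h : ℝ =>
            (Real.fourierChar (h * -inner ℝ x e) : ℂ) - 1).enorm.measurable.pow_const 2
          fun_prop
        calc _ = ∫⁻ h : ℝ, ‖h‖ₑ ^ (-1 - s) *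
              ‖(Real.fourierChar (h * -inner ℝ x e) : ℂ) - 1‖ₑ ^ 2 * (U x * ‖f x‖ₑ ^ 2) := by
              refine lintegral_congr fun h => ?_
              ring
          _ = (∫⁻ h : ℝ, ‖h‖ₑ ^ (-1 - s) *
              ‖(Real.fourierChar (h * -inner ℝ x e) : ℂ) - 1‖ₑ ^ 2) * (U x * ‖f x‖ₑ ^ 2) := by
              rw [lintegral_mul_const _ hm]
          _ ≤ K * ‖-inner ℝ x e‖ₑ ^ s * (U x * ‖f x‖ₑ ^ 2) := by
              gcongr
              exact lintegral_fourierChar_mul_sub_one_le s _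
          _ = _ := by
              rw [enorm_neg]
              ring
    _ = _ := by
        rw [lintegral_const_mul _ (by fun_prop)]

end Weights

section Weights

variable {V : Type*} [NormedAddCommGroup V] [InnerProductSpace ℝ V] [FiniteDimensional ℝ V]
  [MeasurableSpace V] [BorelSpace V]

theorem FourierWeightLE.mono {W W' U U' : V → ℝ≥0∞} (h : FourierWeightLE W U)
    (hW : ∀ x, W' x ≤ W x) (hU : ∀ x, U x ≤ U' x) : FourierWeightLE W' U' := fun f =>
  (lintegral_mono fun x => mul_le_mul' (hW x) le_rfl).trans
    ((h f).trans (lintegral_mono fun x => mul_le_mul' (hU x) le_rfl))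

theorem FourierWeightLE.add {W W' U U' : V → ℝ≥0∞} (h : FourierWeightLE W U)
    (h' : FourierWeightLE W' U') (hW : Measurable W) :
    FourierWeightLE (fun x => W x + W' x) (fun x => U x + U' x) := fun f => by
  have hm := (𝓕 f).continuous.measurable
  simp only [add_mul]
  rw [lintegral_add_left (by fun_prop)]
  exact (add_le_add (h f) (h' f)).trans (le_lintegral_add _ _)

theorem FourierWeightLE.const_mul {W U : V → ℝ≥0∞} (h : FourierWeightLE W U) {A : ℝ≥0∞}
    (hA : A ≠ ⊤) : FourierWeightLE (fun x => A * W x) (fun x => A * U x) := fun f => by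
  simp only [mul_assoc]
  rw [lintegral_const_mul' _ _ hA, lintegral_const_mul' _ _ hA]
  exact mul_le_mul' le_rfl (h f)

theorem FourierWeightLE.sum {ι : Type*} {W U : ι → V → ℝ≥0∞} (t : Finset ι)
    (h : ∀ i ∈ t, FourierWeightLE (W i) (U i)) (hW : ∀ i, Measurable (W i)) :
    FourierWeightLE (fun x => ∑ i ∈ t, W i x) (fun x => ∑ i ∈ t, U i x) := by
  classical
  induction t using Finset.induction_on with
  | empty => intro f; simp
  | insert i t hi ih =>
    simp only [Finset.sum_insert hi]
    exact (h i (Finset.mem_insert_self i t)).add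
      (ih fun j hj => h j (Finset.mem_insert_of_mem hj)) (hW i)

end Weights

/-! ### Geometry of the zero set of the symbol -/

/-- If |ζ| < τ/2 the first alternative holds. Otherwise some coordinate has |ζ_j| ≥ τ/(2n). With d =
τ² - ∑_{i≠j} ζ_i² ≥ 0, the quantity factors as (ζ_j + √d)(ζ_j - √d), and the factor whose two terms
have the same sign is at least |ζ_j| in modulus. -/
theorem exists_coordinate_lower_bound {n : ℕ} {τ : ℝ} (hτ : 0 < τ) (ζ : EuclideanSpace ℝ (Fin n)) :
    τ ^ 2 / 2 ≤ |‖ζ‖ ^ 2 - τ ^ 2| ∨ ∃ (j : Fin n) (σ : Bool),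
      τ * |ζ j - (if σ then 1 else -1) * √(τ ^ 2 - ∑ i ∈ Finset.univ.erase j, ζ i ^ 2)| ≤
        2 * n * |‖ζ‖ ^ 2 - τ ^ 2| := by
  rcases lt_or_ge (‖ζ‖) (τ / 2) with h | h
  · left
    have : ‖ζ‖ ^ 2 ≤ (τ / 2) ^ 2 := by gcongr
    rw [abs_of_neg (by nlinarith)]
    nlinarith
  right
  have hsum : ‖ζ‖ ^ 2 = ∑ i, ζ i ^ 2 := by
    rw [EuclideanSpace.norm_sq_eq]
    simp
  obtain ⟨j, hj⟩ : ∃ j, ‖ζ‖ ^ 2 ≤ n * ζ j ^ 2 := by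
    by_contra! hcon
    have hn : n ≠ 0 := by
      rintro rfl
      simp at hsum
      rw [hsum, norm_zero] at h
      linarith
    have h1 : ∑ j : Fin n, n * ζ j ^ 2 < ∑ j : Fin n, ‖ζ‖ ^ 2 := by
      have : NeZero n := ⟨hn⟩
      exact Finset.sum_lt_sum_of_nonempty Finset.univ_nonempty fun j _ => hcon j
    rw [← Finset.mul_sum, ← hsum] at h1
    simp at h1
  have hn1 : (1 : ℝ) ≤ n := by
    have : n ≠ 0 := by rintro rfl; exact j.elim0
    exact_mod_cast Nat.one_le_iff_ne_zero.2 this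
  have hζ : τ ≤ 2 * n * |ζ j| := by
    refine abs_le_of_sq_le_sq' ?_ (by positivity) |>.2
    rw [mul_pow, sq_abs]
    have h2 : (τ / 2) ^ 2 ≤ ‖ζ‖ ^ 2 := by gcongr
    have h3 : (n : ℝ) * ζ j ^ 2 ≤ n ^ 2 * ζ j ^ 2 := by
      gcongr
      nlinarith
    nlinarith
  set d := τ ^ 2 - ∑ i ∈ Finset.univ.erase j, ζ i ^ 2 with hd
  have ha : ‖ζ‖ ^ 2 - τ ^ 2 = ζ j ^ 2 - d := by
    rw [hsum, hd, ← Finset.add_sum_erase _ _ (Finset.mem_univ j)]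
    ring
  obtain ⟨σ, hσ⟩ : ∃ σ : Bool, |ζ j| * |ζ j - (if σ then 1 else -1) * √d| ≤ |ζ j ^ 2 - d| := by
    -- For d < 0 the line misses the sphere; `√d` is then 0, and ζ_j² ≤ ζ_j² - d still gives the
    -- bound.
    rcases lt_or_ge d 0 with hd0 | hd0
    · refine ⟨true, ?_⟩
      rw [Real.sqrt_eq_zero_of_nonpos hd0.le, mul_zero, sub_zero, ← abs_mul, ← sq,
        abs_of_nonneg (sq_nonneg _), abs_of_nonneg (by nlinarith [sq_nonneg (ζ j)])]
      linarith
    · have hf : ζ j ^ 2 - d = (ζ j + √d) * (ζ j - √d) := by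
        nlinarith [Real.sq_sqrt hd0]
      have hb := Real.sqrt_nonneg d
      rw [hf, abs_mul]
      rcases le_total 0 (ζ j) with h0 | h0
      · refine ⟨true, ?_⟩
        simp only [if_true, one_mul]
        refine mul_le_mul_of_nonneg_right ?_ (abs_nonneg _)
        rw [abs_of_nonneg h0, abs_of_nonneg (by linarith)]
        linarith
      · refine ⟨false, ?_⟩
        simp only [Bool.false_eq_true, if_false, neg_mul, one_mul, sub_neg_eq_add]
        rw [mul_comm]
        refine mul_le_mul_of_nonneg_left ?_ (abs_nonneg _)
        rw [abs_of_nonpos h0, abs_of_nonpos (by linarith)]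
        linarith
  refine ⟨j, σ, ?_⟩
  rw [ha]
  calc _ ≤ 2 * n * |ζ j| * |ζ j - (if σ then 1 else -1) * √d| := by gcongr
    _ = 2 * n * (|ζ j| * |ζ j - (if σ then 1 else -1) * √d|) := by ring
    _ ≤ _ := by gcongr

section SpaceTime

variable {n : ℕ}

theorem inner_timeDir (k : SpaceTime n) : inner ℝ k (timeDir n) = k.snd := by
  simp [timeDir, WithLp.prod_inner_apply]

theorem inner_spaceDir (k : SpaceTime n) (j : Fin n) : inner ℝ k (spaceDir j) = k.fst j := by
  simp [spaceDir, WithLp.prod_inner_apply, EuclideanSpace.inner_single_right]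

theorem norm_timeDir : ‖timeDir n‖ = 1 := by
  simp [timeDir]

theorem norm_spaceDir (j : Fin n) : ‖spaceDir j‖ = 1 := by
  simp [spaceDir]

theorem toLp_imVec_im (τ : ℝ) (ω : EuclideanSpace ℝ (Fin n)) :
    (WithLp.toLp 2 (fun j => (imVec τ ω j).im) : EuclideanSpace ℝ (Fin n)) = τ • ω := by
  ext j
  simp [imVec]

theorem symbolP_imVec_re (τ : ℝ) (hτ : 0 < τ) {ω : EuclideanSpace ℝ (Fin n)} (hω : ‖ω‖ = 1)
    (p : SpaceTime n) : (symbolP (imVec τ ω) p).re = ‖p.fst + τ • ω‖ ^ 2 - τ ^ 2 := by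
  rw [symbolP_re, toLp_imVec_im, norm_smul, hω, Real.norm_of_nonneg hτ.le, mul_one]

theorem symbolP_imVec_im (τ : ℝ) (ω : EuclideanSpace ℝ (Fin n)) (p : SpaceTime n) :
    (symbolP (imVec τ ω) p).im = -p.snd := by
  rw [symbolP_im]
  simp [imVec]

/-- The two points on the line through `k` in the direction of the `j`-th space coordinate where
the real part of the symbol vanishes, if there are any. -/
noncomputable def charCoord (τ : ℝ) (ω : EuclideanSpace ℝ (Fin n)) (j : Fin n) (σ : Bool)
    (k : SpaceTime n) : ℝ :=
  ((if σ then 1 else -1) *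
    √(τ ^ 2 - ∑ i ∈ Finset.univ.erase j, (2 * Real.pi * k.fst i + τ * ω i) ^ 2) - τ * ω j) /
      (2 * Real.pi)

theorem measurable_charCoord (τ : ℝ) (ω : EuclideanSpace ℝ (Fin n)) (j : Fin n) (σ : Bool) :
    Measurable (charCoord τ ω j σ) := by
  have : Continuous (charCoord τ ω j σ) := by
    unfold charCoord
    fun_prop
  exact this.measurable

/-- The j-th coordinate is left out of the sum, so this function is an admissible centre for the
Hardy weight in the direction `spaceDir j`. -/
theorem charCoord_add_spaceDir (τ : ℝ) (ω : EuclideanSpace ℝ (Fin n)) (j : Fin n) (σ : Bool)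
    (k : SpaceTime n) (u : ℝ) :
    charCoord τ ω j σ (k + u • spaceDir j) = charCoord τ ω j σ k := by
  unfold charCoord
  congr 5
  refine Finset.sum_congr rfl fun i hi => ?_
  simp [spaceDir, Finset.ne_of_mem_erase hi]

theorem charCoord_add_timeDir (τ : ℝ) (ω : EuclideanSpace ℝ (Fin n)) (j : Fin n) (σ : Bool)
    (k : SpaceTime n) (u : ℝ) :
    charCoord τ ω j σ (k + u • timeDir n) = charCoord τ ω j σ k := by
  simp [charCoord, timeDir]

theorem exists_symbolP_re_lower_bound {τ : ℝ} (hτ : 0 < τ) {ω : EuclideanSpace ℝ (Fin n)}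
    (hω : ‖ω‖ = 1) (k : SpaceTime n) :
    τ ^ 2 / 2 ≤ |(symbolP (imVec τ ω) ((2 * Real.pi) • k)).re| ∨ ∃ (j : Fin n) (σ : Bool),
      τ * |k.fst j - charCoord τ ω j σ k| ≤
        2 * n * |(symbolP (imVec τ ω) ((2 * Real.pi) • k)).re| := by
  rw [symbolP_imVec_re τ hτ hω]
  refine (exists_coordinate_lower_bound hτ _).imp_right ?_
  rintro ⟨j, σ, h⟩
  refine ⟨j, σ, le_trans (mul_le_mul_of_nonneg_left ?_ hτ.le) h⟩
  have hpi : 1 ≤ 2 * Real.pi := by linarith [Real.two_le_pi]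
  have e : ((2 * Real.pi) • k).fst j + τ * ω j - (if σ then 1 else -1) *
      √(τ ^ 2 - ∑ i ∈ Finset.univ.erase j, (2 * Real.pi * k.fst i + τ * ω i) ^ 2) =
      2 * Real.pi * (k.fst j - charCoord τ ω j σ k) := by
    simp only [charCoord, WithLp.smul_fst, PiLp.smul_apply, smul_eq_mul]
    field_simp
    ring
  have e' : (((2 * Real.pi) • k).fst + τ • ω) j - (if σ then 1 else -1) *
      √(τ ^ 2 - ∑ i ∈ Finset.univ.erase j, (((2 * Real.pi) • k).fst + τ • ω) i ^ 2) =
      2 * Real.pi * (k.fst j - charCoord τ ω j σ k) := by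
    rw [← e]
    simp
  rw [e', abs_mul, abs_of_pos (zero_lt_one.trans_le hpi)]
  exact le_mul_of_one_le_left (abs_nonneg _) hpi

end SpaceTime

/-! ### The weighted estimate for negative powers of the symbol -/

section SpaceTime

variable {n : ℕ}

theorem one_le_weight (p : SpaceTime n) : 1 ≤ weight p := by
  unfold weight
  nlinarith [sq_nonneg ‖p.fst‖, sq_nonneg p.snd]

theorem weight_pos (p : SpaceTime n) : 0 < weight p := zero_lt_one.trans_le (one_le_weight p)

theorem continuous_weight : Continuous (weight (n := n)) := by
  unfold weight
  fun_prop

theorem enorm_rpow_le_weight {s : ℝ} (hs : 0 ≤ s) {y : ℝ} {p : SpaceTime n}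
    (h : y ^ 2 ≤ weight p) : ‖y‖ₑ ^ s ≤ ENNReal.ofReal (weight p ^ (s / 2)) := by
  rw [← ofReal_norm, ENNReal.ofReal_rpow_of_nonneg (norm_nonneg _) hs]
  refine ENNReal.ofReal_le_ofReal ?_
  have h1 : ‖y‖ ^ s = (y ^ 2) ^ (s / 2) := by
    rw [← sq_abs, ← Real.rpow_natCast, ← Real.rpow_mul (abs_nonneg _), Real.norm_eq_abs]
    congr 1
    push_cast
    ring
  rw [h1]
  gcongr

theorem snd_sq_le_weight (p : SpaceTime n) : p.snd ^ 2 ≤ weight p := by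
  unfold weight
  nlinarith [sq_nonneg ‖p.fst‖]

theorem fst_sq_le_weight (p : SpaceTime n) (j : Fin n) : p.fst j ^ 2 ≤ weight p := by
  unfold weight
  have := EuclideanSpace.norm_sq_eq p.fst
  have h2 : p.fst j ^ 2 ≤ ∑ i, ‖p.fst i‖ ^ 2 := by
    refine le_trans (by simp) (Finset.single_le_sum (f := fun i => ‖p.fst i‖ ^ 2)
      (fun i _ => by positivity) (Finset.mem_univ j))
  nlinarith [sq_nonneg p.snd]

theorem ennreal_rpow_neg_le_rpow_neg {s : ℝ} (hs : 0 ≤ s) {a b : ℝ≥0∞} (h : a ≤ b) :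
    b ^ (-s) ≤ a ^ (-s) := by
  rw [ENNReal.rpow_neg, ENNReal.rpow_neg]
  exact ENNReal.inv_le_inv.2 (ENNReal.rpow_le_rpow h hs)

theorem enorm_rpow_neg_le {s : ℝ} (hs : 0 ≤ s) {A : ℝ} (hA : 0 < A) {x y : ℝ}
    (h : A * |y| ≤ |x|) : ‖x‖ₑ ^ (-s) ≤ ENNReal.ofReal (A ^ (-s)) * ‖y‖ₑ ^ (-s) := by
  rw [← ENNReal.ofReal_rpow_of_pos hA,
    ← ENNReal.mul_rpow_of_ne_top ENNReal.ofReal_ne_top enorm_ne_top]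
  refine ennreal_rpow_neg_le_rpow_neg (by linarith) ?_
  rw [← ofReal_norm, ← ofReal_norm, ← ENNReal.ofReal_mul hA.le]
  exact ENNReal.ofReal_le_ofReal h

/-- The symbol `P_{iτω}` in Mathlib's normalization of the Fourier transform. -/
noncomputable abbrev rescaledSymbol (τ : ℝ) (ω : EuclideanSpace ℝ (Fin n)) (k : SpaceTime n) : ℂ :=
  symbolP (imVec τ ω) ((2 * Real.pi) • k)

theorem continuous_rescaledSymbol (τ : ℝ) (ω : EuclideanSpace ℝ (Fin n)) :
    Continuous (rescaledSymbol τ ω) := by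
  unfold rescaledSymbol symbolP
  fun_prop

/-- One factor is estimated by Im P and the other by Re P. The sum over (j, σ) removes the
dependence of the good coordinate and sign on k. The factors `1 *` and the terms `- 0` match the
form produced by `exists_fourierWeightLE_mul`. -/
theorem enorm_rpow_neg_rescaledSymbol_le {s : ℝ} (hs : 0 < s) {τ : ℝ} (hτ : 0 < τ)
    {ω : EuclideanSpace ℝ (Fin n)} (hω : ‖ω‖ = 1) (k : SpaceTime n) :
    ‖rescaledSymbol τ ω k‖ₑ ^ (-s) * ‖rescaledSymbol τ ω k‖ₑ ^ (-s) ≤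
      ENNReal.ofReal ((τ ^ 2 / 2) ^ (-s)) * (1 * ‖inner ℝ k (timeDir n) - 0‖ₑ ^ (-s)) +
        ∑ p : Fin n × Bool, ENNReal.ofReal ((τ / (2 * n)) ^ (-s)) *
          (1 * ‖inner ℝ k (spaceDir p.1) - charCoord τ ω p.1 p.2 k‖ₑ ^ (-s) *
            ‖inner ℝ k (timeDir n) - 0‖ₑ ^ (-s)) := by
  set w := rescaledSymbol τ ω k with hw
  have him : ‖w‖ₑ ^ (-s) ≤ ‖inner ℝ k (timeDir n) - 0‖ₑ ^ (-s) := by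
    refine ennreal_rpow_neg_le_rpow_neg (by linarith) ?_
    rw [inner_timeDir, sub_zero, ← ofReal_norm, ← ofReal_norm]
    refine ENNReal.ofReal_le_ofReal (le_trans ?_ (Complex.abs_im_le_norm w))
    rw [hw, symbolP_imVec_im, abs_neg, WithLp.smul_snd, smul_eq_mul, abs_mul,
      abs_of_pos (by positivity), Real.norm_eq_abs]
    exact le_mul_of_one_le_left (abs_nonneg _) (by linarith [Real.two_le_pi])
  have hre : ‖w‖ₑ ^ (-s) ≤ ‖w.re‖ₑ ^ (-s) := by
    refine ennreal_rpow_neg_le_rpow_neg (by linarith) ?_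
    rw [← ofReal_norm, ← ofReal_norm]
    exact ENNReal.ofReal_le_ofReal (Complex.abs_re_le_norm w)
  have hre' : ‖w.re‖ₑ ^ (-s) ≤ ENNReal.ofReal ((τ ^ 2 / 2) ^ (-s)) +
      ∑ p : Fin n × Bool, ENNReal.ofReal ((τ / (2 * n)) ^ (-s)) *
        ‖inner ℝ k (spaceDir p.1) - charCoord τ ω p.1 p.2 k‖ₑ ^ (-s) := by
    rcases exists_symbolP_re_lower_bound hτ hω k with h | ⟨j, σ, h⟩
    · refine le_add_right ?_
      have := enorm_rpow_neg_le (y := 1) hs.le (A := τ ^ 2 / 2) (by positivity) (x := w.re)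
        (by simpa using h)
      simpa using this
    · refine le_add_left (le_trans ?_ (Finset.single_le_sum (fun _ _ => by positivity)
        (Finset.mem_univ (j, σ))))
      have hn : (0 : ℝ) < n := by
        have : n ≠ 0 := by rintro rfl; exact j.elim0
        positivity
      refine enorm_rpow_neg_le hs.le (by positivity) ?_
      rw [inner_spaceDir]
      rw [div_mul_eq_mul_div, div_le_iff₀ (by positivity), mul_comm |w.re|]
      exact h
  refine (mul_le_mul' (hre.trans hre') him).trans_eq ?_
  rw [add_mul, Finset.sum_mul]
  simp only [one_mul, mul_assoc]

/-- Each summand of the pointwise bound comes from one Hardy step in time, or from one in space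
followed by one in time. The parameter m ≥ max(1, 1/τ) keeps K independent of τ. -/
theorem exists_lintegral_symbol_rpow_le (n : ℕ) {s : ℝ} (hs0 : 0 < s) (hs1 : s < 1) :
    ∃ K : ℝ≥0∞, K ≠ ⊤ ∧ ∀ (τ m : ℝ) (ω : EuclideanSpace ℝ (Fin n)), 0 < τ → 1 ≤ m → 1 ≤ m * τ →
      ‖ω‖ = 1 → FourierWeightLE
        (fun k => ‖rescaledSymbol τ ω k‖ₑ ^ (-s) * ‖rescaledSymbol τ ω k‖ₑ ^ (-s))
        (fun p => K * ENNReal.ofReal (m ^ (2 * s)) * ENNReal.ofReal (weight p ^ s)) := by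
  obtain ⟨C, hC, hCW⟩ := exists_fourierWeightLE_mul (V := SpaceTime n) hs0 hs1
  refine ⟨ENNReal.ofReal (2 ^ s) * C + Fintype.card (Fin n × Bool) *
      (ENNReal.ofReal ((2 * n) ^ s) * (C * C)), by finiteness, fun τ m ω hτ hm hmτ hω => ?_⟩
  have hi (e : SpaceTime n) : Measurable fun y : SpaceTime n => inner ℝ y e := by fun_prop
  have htime : FourierWeightLE (fun k : SpaceTime n => 1 * ‖inner ℝ k (timeDir n) - 0‖ₑ ^ (-s))
      (fun p => C * (1 * ‖inner ℝ p (timeDir n)‖ₑ ^ s)) :=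
    hCW (timeDir n) (fun _ => 0) (fun _ => 1) (fun _ => 1) norm_timeDir measurable_const
      (fun _ _ => rfl) measurable_const (fun _ _ => rfl) measurable_const fourierWeightLE_one
  have hc := measurable_charCoord τ ω
  have hspace (p : Fin n × Bool) : FourierWeightLE
      (fun k : SpaceTime n => 1 * ‖inner ℝ k (spaceDir p.1) - charCoord τ ω p.1 p.2 k‖ₑ ^ (-s))
      (fun x => C * (1 * ‖inner ℝ x (spaceDir p.1)‖ₑ ^ s)) :=
    hCW (spaceDir p.1) _ (fun _ => 1) (fun _ => 1) (norm_spaceDir _) (hc p.1 p.2)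
      (charCoord_add_spaceDir τ ω p.1 p.2) measurable_const (fun _ _ => rfl) measurable_const
      fourierWeightLE_one
  -- The second Hardy step starts from the spatial weight, which is constant in the time direction.
  have hboth (p : Fin n × Bool) : FourierWeightLE
      (fun k : SpaceTime n => 1 * ‖inner ℝ k (spaceDir p.1) - charCoord τ ω p.1 p.2 k‖ₑ ^ (-s) *
        ‖inner ℝ k (timeDir n) - 0‖ₑ ^ (-s))
      (fun x => C * (C * (1 * ‖inner ℝ x (spaceDir p.1)‖ₑ ^ s) *
        ‖inner ℝ x (timeDir n)‖ₑ ^ s)) := by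
    have hcp := hc p.1 p.2
    have hip := hi (spaceDir p.1)
    refine hCW (timeDir n) (fun _ => 0) _ _ norm_timeDir measurable_const (fun _ _ => rfl)
      (by fun_prop) (fun x u => ?_) (by fun_prop) (hspace p)
    simp only [charCoord_add_timeDir, inner_spaceDir]
    simp [timeDir]
  have hit := hi (timeDir n)
  have hmeas (p : Fin n × Bool) : Measurable fun k : SpaceTime n =>
      ENNReal.ofReal ((τ / (2 * n)) ^ (-s)) *
        (1 * ‖inner ℝ k (spaceDir p.1) - charCoord τ ω p.1 p.2 k‖ₑ ^ (-s) *
        ‖inner ℝ k (timeDir n) - 0‖ₑ ^ (-s)) := by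
    have hcp := hc p.1 p.2
    have hip := hi (spaceDir p.1)
    fun_prop
  refine ((htime.const_mul (A := ENNReal.ofReal ((τ ^ 2 / 2) ^ (-s))) ENNReal.ofReal_ne_top).add
    (FourierWeightLE.sum Finset.univ (fun p _ => (hboth p).const_mul
      (A := ENNReal.ofReal ((τ / (2 * n)) ^ (-s))) ENNReal.ofReal_ne_top) hmeas)
    (by fun_prop)).mono (enorm_rpow_neg_rescaledSymbol_le hs0 hτ hω) fun x => ?_
  have hw1 := one_le_weight x
  have ht : ‖inner ℝ x (timeDir n)‖ₑ ^ s ≤ ENNReal.ofReal (weight x ^ (s / 2)) := by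
    rw [inner_timeDir]
    exact enorm_rpow_le_weight hs0.le (snd_sq_le_weight x)
  have ht' : ‖inner ℝ x (timeDir n)‖ₑ ^ s ≤ ENNReal.ofReal (weight x ^ s) :=
    ht.trans (ENNReal.ofReal_le_ofReal (Real.rpow_le_rpow_of_exponent_le hw1 (by linarith)))
  have hx (j : Fin n) : ‖inner ℝ x (spaceDir j)‖ₑ ^ s * ‖inner ℝ x (timeDir n)‖ₑ ^ s ≤
      ENNReal.ofReal (weight x ^ s) := by
    have h1 : ‖inner ℝ x (spaceDir j)‖ₑ ^ s ≤ ENNReal.ofReal (weight x ^ (s / 2)) := by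
      rw [inner_spaceDir]
      exact enorm_rpow_le_weight hs0.le (fst_sq_le_weight x j)
    refine (mul_le_mul' h1 ht).trans_eq ?_
    rw [← ENNReal.ofReal_mul (Real.rpow_nonneg (weight_pos x).le _),
      ← Real.rpow_add (weight_pos x)]
    ring_nf
  -- The two alternatives for Re P cost τ^{-2s} and τ^{-s}; both are at most m^{2s}, the second
  -- because m ≥ 1.
  have hτm : τ ^ (-s) ≤ m ^ s := by
    rw [Real.rpow_neg hτ.le, ← Real.inv_rpow hτ.le]
    refine Real.rpow_le_rpow (by positivity) ?_ hs0.le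
    rw [inv_le_iff_one_le_mul₀ hτ]
    exact hmτ
  have hA : (τ ^ 2 / 2) ^ (-s) ≤ 2 ^ s * m ^ (2 * s) := by
    have e1 : (τ ^ 2 / 2) ^ (-s) = 2 ^ s * (τ ^ (-s) * τ ^ (-s)) := by
      rw [div_eq_mul_inv, Real.mul_rpow (by positivity) (by positivity), sq,
        Real.mul_rpow hτ.le hτ.le, Real.inv_rpow (by positivity),
        ← Real.rpow_neg (by positivity : (0 : ℝ) ≤ 2), neg_neg, mul_comm]
    rw [e1, two_mul s, Real.rpow_add (by linarith)]
    gcongr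
  have hB : (τ / (2 * n)) ^ (-s) ≤ (2 * n) ^ s * m ^ (2 * s) := by
    have e1 : (τ / (2 * n)) ^ (-s) = (2 * n) ^ s * τ ^ (-s) := by
      rw [div_eq_mul_inv, Real.mul_rpow hτ.le (by positivity), Real.inv_rpow (by positivity),
        Real.rpow_neg (by positivity : (0 : ℝ) ≤ 2 * n) s, inv_inv, mul_comm]
    rw [e1]
    gcongr
    exact hτm.trans (Real.rpow_le_rpow_of_exponent_le hm (by linarith))
  have hA' : ENNReal.ofReal ((τ ^ 2 / 2) ^ (-s)) ≤
      ENNReal.ofReal (2 ^ s) * ENNReal.ofReal (m ^ (2 * s)) := by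
    rw [← ENNReal.ofReal_mul (by positivity)]
    exact ENNReal.ofReal_le_ofReal hA
  have hB' : ENNReal.ofReal ((τ / (2 * n)) ^ (-s)) ≤
      ENNReal.ofReal ((2 * n) ^ s) * ENNReal.ofReal (m ^ (2 * s)) := by
    rw [← ENNReal.ofReal_mul (by positivity)]
    exact ENNReal.ofReal_le_ofReal hB
  have hS : ∑ p : Fin n × Bool, ENNReal.ofReal ((τ / (2 * n)) ^ (-s)) *
      (C * (C * (1 * ‖inner ℝ x (spaceDir p.1)‖ₑ ^ s) * ‖inner ℝ x (timeDir n)‖ₑ ^ s)) ≤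
      ∑ p : Fin n × Bool, ENNReal.ofReal ((2 * n) ^ s) * ENNReal.ofReal (m ^ (2 * s)) *
      (C * C * ENNReal.ofReal (weight x ^ s)) := by
    refine Finset.sum_le_sum fun p _ => mul_le_mul' hB' ?_
    rw [one_mul, mul_assoc C, mul_assoc C]
    exact mul_le_mul' le_rfl (mul_le_mul' le_rfl (hx p.1))
  rw [Finset.sum_const, nsmul_eq_mul, Finset.card_univ] at hS
  refine (add_le_add (mul_le_mul' hA' (mul_le_mul' le_rfl (mul_le_mul' le_rfl ht'))) hS).trans_eq ?_
  ring

end SpaceTime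

/-! ### The bilinear estimate -/

/-- The Cauchy–Schwarz inequality for the Lebesgue integral. -/
theorem lintegral_mul_le_sqrt_mul_sqrt {X : Type*} [MeasurableSpace X] {μ : Measure X}
    {f g : X → ℝ≥0∞} (hf : AEMeasurable f μ) (hg : AEMeasurable g μ) :
    ∫⁻ x, f x * g x ∂μ ≤
      (∫⁻ x, f x ^ 2 ∂μ) ^ (1 / 2 : ℝ) * (∫⁻ x, g x ^ 2 ∂μ) ^ (1 / 2 : ℝ) := by
  have h := ENNReal.lintegral_mul_le_Lp_mul_Lq μ Real.HolderConjugate.two_two hf hg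
  simpa only [ENNReal.rpow_two, Pi.mul_apply] using h

section SpaceTime

variable {n : ℕ}

/-- The weighted norm as an extended nonnegative number. -/
noncomputable def weightedENorm (s : ℝ) (f : SpaceTime n → ℂ) : ℝ≥0∞ :=
  (∫⁻ p, ENNReal.ofReal (weight p ^ s) * ‖f p‖ₑ ^ 2) ^ (1 / 2 : ℝ)

theorem weight_neg (p : SpaceTime n) : weight (-p) = weight p := by
  simp [weight]

theorem weight_eq (p : SpaceTime n) : weight p = 1 + ‖p‖ ^ 2 := by
  rw [weight, WithLp.prod_norm_sq_eq_of_L2, Real.norm_eq_abs, sq_abs, add_assoc]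

theorem weightedENorm_comp_neg (s : ℝ) (f : SpaceTime n → ℂ) :
    weightedENorm s (fun p => f (-p)) = weightedENorm s f := by
  unfold weightedENorm
  congr 1
  rw [← lintegral_neg_eq_self (fun p => ENNReal.ofReal (weight p ^ s) * ‖f p‖ₑ ^ 2)]
  simp only [weight_neg]

theorem integrable_weight_rpow {s : ℝ} (hs : s ≤ 1) (f : 𝓢(SpaceTime n, ℂ)) :
    Integrable (fun p => ‖f p‖ ^ 2 * weight p ^ s) := by
  obtain ⟨M, hM⟩ : ∃ M, ∀ p, ‖f p‖ ≤ M :=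
    ⟨_, fun p => SchwartzMap.norm_le_seminorm ℝ f p⟩
  have h := ((f.integrable_pow_mul volume 0).add (f.integrable_pow_mul volume 2)).const_mul M
  have hc := f.continuous
  have hw : Continuous fun p : SpaceTime n => weight p ^ s :=
    continuous_weight.rpow_const fun p => Or.inl (weight_pos p).ne'
  refine h.mono' (by fun_prop) (Filter.Eventually.of_forall fun p => ?_)
  have hwp := (weight_pos p).le
  rw [Real.norm_of_nonneg (by positivity)]
  calc ‖f p‖ ^ 2 * weight p ^ s ≤ ‖f p‖ ^ 2 * weight p ^ (1 : ℝ) := by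
        gcongr
        exact one_le_weight p
    _ = ‖f p‖ * (‖f p‖ * (1 + ‖p‖ ^ 2)) := by rw [Real.rpow_one, weight_eq]; ring
    _ ≤ M * (‖f p‖ * (1 + ‖p‖ ^ 2)) := by
        gcongr
        exact hM p
    _ = _ := by simp only [Pi.add_apply]; ring

theorem weightedENorm_eq_ofReal {s : ℝ} {f : SpaceTime n → ℂ}
    (hf : Integrable (fun p => ‖f p‖ ^ 2 * weight p ^ s)) :
    weightedENorm s f = ENNReal.ofReal (weightedNorm s f) := by
  have h0 (p : SpaceTime n) : 0 ≤ ‖f p‖ ^ 2 * weight p ^ s :=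
    mul_nonneg (by positivity) (Real.rpow_nonneg (weight_pos p).le _)
  unfold weightedENorm weightedNorm
  rw [← ENNReal.ofReal_rpow_of_nonneg (integral_nonneg h0) (by norm_num),
    ofReal_integral_eq_lintegral_ofReal hf (Filter.Eventually.of_forall h0)]
  congr 1
  refine lintegral_congr fun p => ?_
  rw [ENNReal.ofReal_mul (by positivity), ENNReal.ofReal_pow (norm_nonneg _), ofReal_norm, mul_comm]

theorem lintegral_enorm_sq_rpow_le_weightedENorm {s : ℝ} (hs : 0 ≤ s) (f : SpaceTime n → ℂ) :
    (∫⁻ p, ‖f p‖ₑ ^ 2) ^ (1 / 2 : ℝ) ≤ weightedENorm s f := by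
  unfold weightedENorm
  gcongr with p
  refine le_mul_of_one_le_left zero_le ?_
  rw [ENNReal.one_le_ofReal]
  exact Real.one_le_rpow (one_le_weight p) hs

theorem fourierInv_eq_fourier_compNeg (f : 𝓢(SpaceTime n, ℂ)) :
    𝓕⁻ f = 𝓕 (compCLMOfContinuousLinearEquiv ℂ (ContinuousLinearEquiv.neg ℝ) f) := by
  ext x
  rw [fourierInv_coe, fourier_coe, Real.fourierInv_eq_fourier_comp_neg]
  rfl

/-- Here |η| = |Im P|, and |ξ|² ≤ 2|ξ + τω|² + 2τ² = 2 Re P + 4τ². -/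
theorem norm_sq_fst_add_le {τ : ℝ} (hτ : 0 < τ) {ω : EuclideanSpace ℝ (Fin n)} (hω : ‖ω‖ = 1)
    (p : SpaceTime n) :
    ‖p.fst‖ ^ 2 + |p.snd| ≤ 3 * ‖symbolP (imVec τ ω) p‖ + 4 * τ ^ 2 := by
  have him := Complex.abs_im_le_norm (symbolP (imVec τ ω) p)
  have hre := (le_abs_self _).trans (Complex.abs_re_le_norm (symbolP (imVec τ ω) p))
  rw [symbolP_imVec_im, abs_neg] at him
  rw [symbolP_imVec_re τ hτ hω] at hre
  have h1 : ‖p.fst‖ ≤ ‖p.fst + τ • ω‖ + τ := by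
    have := norm_sub_le (p.fst + τ • ω) (τ • ω)
    rwa [add_sub_cancel_right, norm_smul, hω, mul_one, Real.norm_of_nonneg hτ.le] at this
  have h2 : ‖p.fst‖ ^ 2 ≤ (‖p.fst + τ • ω‖ + τ) ^ 2 := by gcongr
  nlinarith [sq_nonneg (‖p.fst + τ • ω‖ - τ), norm_nonneg (p.fst + τ • ω)]

theorem pow_mul_pow_le {x y τ : ℝ} (hy : 0 ≤ y) (hτ : 0 < τ) {a b : ℕ}
    (h : a + 2 * b ≤ 2) :
    x ^ a * y ^ b ≤ τ ^ (a + 2 * b) * (1 + (x ^ 2 + y) / τ ^ 2) := by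
  have hτ2 : 0 < τ ^ 2 := by positivity
  have e (c : ℝ) : c * (1 + (x ^ 2 + y) / τ ^ 2) = c / τ ^ 2 * (τ ^ 2 + (x ^ 2 + y)) := by
    field_simp
  obtain ⟨rfl, rfl⟩ | ⟨rfl, rfl⟩ | ⟨rfl, rfl⟩ | ⟨rfl, rfl⟩ :
      (a = 0 ∧ b = 0) ∨ (a = 1 ∧ b = 0) ∨ (a = 2 ∧ b = 0) ∨ (a = 0 ∧ b = 1) := by omega
  · simp only [pow_zero, mul_zero, add_zero, one_mul]
    have : 0 ≤ (x ^ 2 + y) / τ ^ 2 := by positivity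
    linarith
  · have e1 : τ ^ 1 / τ ^ 2 = τ⁻¹ := by field_simp
    rw [e, mul_zero, add_zero, pow_one x, pow_zero, mul_one, e1, inv_mul_eq_div, le_div_iff₀ hτ]
    nlinarith [sq_nonneg (x - τ)]
  · rw [e, mul_zero, add_zero, div_self hτ2.ne']
    nlinarith
  · rw [e, mul_one, zero_add, div_self hτ2.ne']
    nlinarith

/-- In the parabolic scaling |ξ| ~ τ, |η| ~ τ², a monomial of order at most two is at most τ^{a+2b}
(1 + (|ξ|² + |η|)/τ²). The bound of |ξ|² + |η| by 3|P| + 4τ² then gives 5 = 1 + 4 and 3. -/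
theorem norm_monomial_div_symbolP_le {τ : ℝ} (hτ : 0 < τ) {ω : EuclideanSpace ℝ (Fin n)}
    (hω : ‖ω‖ = 1) (p : SpaceTime n) {a b : ℕ} (h : a + 2 * b ≤ 2) :
    ‖1 / symbolP (imVec τ ω) p‖ * (‖p.fst‖ ^ a * |p.snd| ^ b) ≤
      τ ^ (a + 2 * b) * (5 * ‖1 / symbolP (imVec τ ω) p‖ + 3 / τ ^ 2) := by
  have h1 := pow_mul_pow_le (x := ‖p.fst‖) (abs_nonneg p.snd) hτ h
  have h2 := norm_sq_fst_add_le hτ hω p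
  have hτ2 : 0 < τ ^ 2 := by positivity
  rw [norm_div, norm_one]
  set P := ‖symbolP (imVec τ ω) p‖ with hP
  have hP0 : 0 ≤ P := norm_nonneg _
  have h3 : ‖p.fst‖ ^ a * |p.snd| ^ b ≤ τ ^ (a + 2 * b) * (5 + 3 / τ ^ 2 * P) := by
    refine h1.trans ?_
    gcongr ?_ * ?_
    calc 1 + (‖p.fst‖ ^ 2 + |p.snd|) / τ ^ 2 ≤ 1 + (3 * P + 4 * τ ^ 2) / τ ^ 2 := by gcongr
      _ = _ := by field_simp; ring
  calc 1 / P * (‖p.fst‖ ^ a * |p.snd| ^ b) ≤ 1 / P * (τ ^ (a + 2 * b) * (5 + 3 / τ ^ 2 * P)) := by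
        gcongr
    _ = τ ^ (a + 2 * b) * (5 * (1 / P) + 3 / τ ^ 2 * (P / P)) := by ring
    _ ≤ τ ^ (a + 2 * b) * (5 * (1 / P) + 3 / τ ^ 2 * 1) := by
        gcongr
        -- At zeros of P the quotient is 0, so the inequality needs no exception there.
        exact div_self_le_one P
    _ = _ := by rw [mul_one]

theorem enorm_inv_le_rpow_mul_rpow {s : ℝ} (w : ℂ) :
    ‖1 / w‖ₑ ≤ ‖w‖ₑ ^ (-s) * ‖w‖ₑ ^ (-(1 - s)) := by
  rcases eq_or_ne w 0 with rfl | hw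
  · simp
  · rw [← ENNReal.rpow_add _ _ (by simpa using hw) (by simp), one_div, enorm_inv hw,
      ← ENNReal.rpow_neg_one]
    ring_nf
    rfl

theorem exists_sqrt_lintegral_symbol_le (n : ℕ) {s : ℝ} (hs0 : 0 < s) (hs1 : s < 1) :
    ∃ K : ℝ≥0∞, K ≠ ⊤ ∧ ∀ (τ m : ℝ) (ω : EuclideanSpace ℝ (Fin n)), 0 < τ → 1 ≤ m → 1 ≤ m * τ →
      ‖ω‖ = 1 → ∀ f : 𝓢(SpaceTime n, ℂ),
        (∫⁻ k, (‖rescaledSymbol τ ω k‖ₑ ^ (-s) * ‖𝓕 f k‖ₑ) ^ 2) ^ (1 / 2 : ℝ) ≤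
          K * ENNReal.ofReal (m ^ s) * weightedENorm s f := by
  obtain ⟨K, hK, h⟩ := exists_lintegral_symbol_rpow_le n hs0 hs1
  refine ⟨K ^ (1 / 2 : ℝ), by finiteness, fun τ m ω hτ hm hmτ hω f => ?_⟩
  have h1 := h τ m ω hτ hm hmτ hω f
  simp only [mul_assoc] at h1
  rw [lintegral_const_mul' _ _ hK, lintegral_const_mul' _ _ ENNReal.ofReal_ne_top] at h1
  have h2 := ENNReal.rpow_le_rpow h1 (by norm_num : (0 : ℝ) ≤ 1 / 2)
  rw [ENNReal.mul_rpow_of_nonneg _ _ (by norm_num), ENNReal.mul_rpow_of_nonneg _ _ (by norm_num),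
    ENNReal.ofReal_rpow_of_nonneg (by positivity) (by norm_num), ← Real.rpow_mul (by linarith)] at h2
  have e : 2 * s * (1 / 2) = s := by ring
  rw [e] at h2
  rw [mul_assoc]
  refine le_trans (le_of_eq ?_) h2
  congr 1
  refine lintegral_congr fun k => ?_
  ring

/-- Splitting 1/|P| into the powers s and 1 - s gives the constants m^s and m^{1-s}, whose product
is m. This linear power becomes C(R)^{-1/2}. -/
theorem exists_lintegral_bilinear_le (n : ℕ) {s : ℝ} (hs0 : 0 < s) (hs1 : s < 1) :
    ∃ C : ℝ, 0 < C ∧ ∀ (τ m : ℝ) (ω : EuclideanSpace ℝ (Fin n)) (a b : ℕ), 0 < τ → 1 ≤ m →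
      1 ≤ m * τ → 1 ≤ m * τ ^ 2 → ‖ω‖ = 1 → a + 2 * b ≤ 2 → ∀ f g : 𝓢(SpaceTime n, ℂ),
      ∫⁻ k : SpaceTime n, ‖1 / rescaledSymbol τ ω k‖ₑ *
          ENNReal.ofReal (‖((2 * Real.pi) • k).fst‖ ^ a * |((2 * Real.pi) • k).snd| ^ b) *
            (‖𝓕 f k‖ₑ * ‖𝓕⁻ g k‖ₑ) ≤
        ENNReal.ofReal (C * τ ^ (a + 2 * b) * m) *
          (weightedENorm s f * weightedENorm (1 - s) g) := by
  obtain ⟨K, hK, hKf⟩ := exists_sqrt_lintegral_symbol_le n hs0 hs1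
  obtain ⟨K', hK', hKg⟩ := exists_sqrt_lintegral_symbol_le n (s := 1 - s) (by linarith)
    (by linarith)
  refine ⟨5 * (K * K').toReal + 3, by positivity,
    fun τ m ω a b hτ hm hmτ hmτ2 hω hab f g => ?_⟩
  -- Reflection turns 𝓕⁻ into 𝓕 and preserves the norms, because the weight is even.
  set g' := compCLMOfContinuousLinearEquiv ℂ (ContinuousLinearEquiv.neg ℝ) g with hg'
  have hgN (r : ℝ) : weightedENorm r g' = weightedENorm r g := weightedENorm_comp_neg r g
  rw [fourierInv_eq_fourier_compNeg, ← hg', ← hgN]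
  have hPm := (continuous_rescaledSymbol τ ω).measurable
  have hfm := (𝓕 f).continuous.measurable
  have hgm := (𝓕 g').continuous.measurable
  set N := weightedENorm s f * weightedENorm (1 - s) g' with hN
  have hsing : ∫⁻ k, ‖1 / rescaledSymbol τ ω k‖ₑ * (‖𝓕 f k‖ₑ * ‖𝓕 g' k‖ₑ) ≤
      K * K' * ENNReal.ofReal m * N := by
    calc _ ≤ ∫⁻ k, (‖rescaledSymbol τ ω k‖ₑ ^ (-s) * ‖𝓕 f k‖ₑ) *
          (‖rescaledSymbol τ ω k‖ₑ ^ (-(1 - s)) * ‖𝓕 g' k‖ₑ) := by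
          refine lintegral_mono fun k => ?_
          rw [mul_mul_mul_comm]
          exact mul_le_mul' (enorm_inv_le_rpow_mul_rpow _) le_rfl
      _ ≤ _ := lintegral_mul_le_sqrt_mul_sqrt (by fun_prop) (by fun_prop)
      _ ≤ (K * ENNReal.ofReal (m ^ s) * weightedENorm s f) *
          (K' * ENNReal.ofReal (m ^ (1 - s)) * weightedENorm (1 - s) g') :=
          mul_le_mul' (hKf τ m ω hτ hm hmτ hω f) (hKg τ m ω hτ hm hmτ hω g')
      _ = K * K' * (ENNReal.ofReal (m ^ s) * ENNReal.ofReal (m ^ (1 - s))) * N := by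
          rw [hN]; ring
      _ = _ := by
          rw [← ENNReal.ofReal_mul (by positivity), ← Real.rpow_add (by linarith)]
          simp
  -- For the term 3/τ² in the monomial bound no singular weight is left: Plancherel suffices, and
  -- 3/τ² ≤ 3m.
  have hreg : ∫⁻ k, ‖𝓕 f k‖ₑ * ‖𝓕 g' k‖ₑ ≤ N := by
    refine (lintegral_mul_le_sqrt_mul_sqrt (by fun_prop) (by fun_prop)).trans ?_
    rw [lintegral_enorm_sq_fourier, lintegral_enorm_sq_fourier]
    exact mul_le_mul' (lintegral_enorm_sq_rpow_le_weightedENorm hs0.le _)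
      (lintegral_enorm_sq_rpow_le_weightedENorm (by linarith) _)
  set T := ENNReal.ofReal (τ ^ (a + 2 * b)) with hT
  calc _ ≤ ∫⁻ k, T * (5 * (‖1 / rescaledSymbol τ ω k‖ₑ * (‖𝓕 f k‖ₑ * ‖𝓕 g' k‖ₑ)) +
        ENNReal.ofReal (3 / τ ^ 2) * (‖𝓕 f k‖ₑ * ‖𝓕 g' k‖ₑ)) := by
        refine lintegral_mono fun k => ?_
        rw [← mul_assoc 5, ← add_mul, ← mul_assoc T]
        refine mul_le_mul' ?_ le_rfl
        have h := ENNReal.ofReal_le_ofReal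
          (norm_monomial_div_symbolP_le hτ hω ((2 * Real.pi) • k) hab)
        rw [ENNReal.ofReal_mul (norm_nonneg _), ofReal_norm,
          ENNReal.ofReal_mul (pow_nonneg hτ.le (a + 2 * b)),
          ENNReal.ofReal_add (by positivity) (by positivity),
          ENNReal.ofReal_mul (p := 5) (by norm_num), ofReal_norm, ENNReal.ofReal_ofNat] at h
        exact h
    _ = T * (5 * (∫⁻ k, ‖1 / rescaledSymbol τ ω k‖ₑ * (‖𝓕 f k‖ₑ * ‖𝓕 g' k‖ₑ)) +
        ENNReal.ofReal (3 / τ ^ 2) * ∫⁻ k, ‖𝓕 f k‖ₑ * ‖𝓕 g' k‖ₑ) := by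
        rw [lintegral_const_mul' _ _ ENNReal.ofReal_ne_top, lintegral_add_right _ (by fun_prop),
          lintegral_const_mul' _ _ (by finiteness), lintegral_const_mul' _ _ (by finiteness)]
    _ ≤ T * (5 * (K * K' * ENNReal.ofReal m * N) + ENNReal.ofReal (3 * m) * N) := by
        gcongr
        rw [div_le_iff₀ (by positivity)]
        linarith
    _ = _ := by
        have e1 : ENNReal.ofReal (5 * (K * K').toReal + 3) = 5 * (K * K') + 3 := by
          rw [ENNReal.ofReal_add (by positivity) (by positivity), ENNReal.ofReal_mul (by norm_num),
            ENNReal.ofReal_toReal (by finiteness)]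
          simp only [ENNReal.ofReal_ofNat]
        rw [mul_assoc (5 * (K * K').toReal + 3), ENNReal.ofReal_mul (by positivity) (q := _ * m),
          ENNReal.ofReal_mul (pow_nonneg hτ.le (a + 2 * b)) (q := m), e1, ENNReal.ofReal_mul (by norm_num)]
        simp only [ENNReal.ofReal_ofNat]
        ring

end SpaceTime

/-! ### Duality and weighted L² representatives -/

/-- A linear functional bounded by the norm of a linear map into a Hilbert space is represented
by a vector. -/
theorem exists_inner_eq_of_norm_le {S H : Type*} [AddCommGroup S] [Module ℂ S]
    [NormedAddCommGroup H] [InnerProductSpace ℂ H] [CompleteSpace H] (ι : S →ₗ[ℂ] H)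
    (T : S →ₗ[ℂ] ℂ) {K : ℝ} (hK : 0 ≤ K) (h : ∀ φ, ‖T φ‖ ≤ K * ‖ι φ‖) :
    ∃ v : H, ‖v‖ ≤ K ∧ ∀ φ, T φ = inner ℂ v (ι φ) := by
  -- The map r chooses preimages linearly; the bound on T makes T ∘ r independent of the choice. The
  -- functional on the range is then extended by Hahn–Banach, so the range need not be dense.
  obtain ⟨r, hr⟩ := ι.rangeRestrict.exists_rightInverse_of_surjective ι.range_rangeRestrict
  have hr' (x : LinearMap.range ι) : ι (r x) = x := by
    have := congrArg Subtype.val (LinearMap.congr_fun hr x)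
    simpa using this
  set T₀ : LinearMap.range ι →L[ℂ] ℂ := (T ∘ₗ r).mkContinuous K fun x => by
    have := h (r x)
    rwa [hr'] at this with hT₀
  obtain ⟨L, hL, hLn⟩ := exists_extension_norm_eq _ T₀
  refine ⟨(InnerProductSpace.toDual ℂ H).symm L, ?_, fun φ => ?_⟩
  · rw [LinearIsometryEquiv.norm_map, hLn]
    exact LinearMap.mkContinuous_norm_le _ hK _
  · rw [InnerProductSpace.toDual_symm_apply]
    have h1 := hL ⟨ι φ, φ, rfl⟩
    change L (ι φ) = T (r ⟨ι φ, φ, rfl⟩) at h1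
    rw [h1, ← sub_eq_zero, ← map_sub, ← norm_le_zero_iff]
    refine (h _).trans_eq ?_
    rw [map_sub, hr', sub_self, norm_zero, mul_zero]

section SpaceTime

variable {n : ℕ}

theorem continuous_weight_rpow (s : ℝ) : Continuous fun p : SpaceTime n => weight p ^ s :=
  continuous_weight.rpow_const fun p => Or.inl (weight_pos p).ne'

theorem norm_weight_rpow_smul_sq (s : ℝ) (p : SpaceTime n) (c : ℂ) :
    ‖weight p ^ (s / 2) • c‖ ^ 2 = ‖c‖ ^ 2 * weight p ^ s := by
  have hw := weight_pos p
  rw [norm_smul, mul_pow, Real.norm_of_nonneg (Real.rpow_nonneg hw.le _), ← Real.rpow_natCast,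
    ← Real.rpow_mul hw.le, mul_comm]
  congr 2
  push_cast
  ring

theorem memLp_weight_rpow_smul {s : ℝ} (hs : s ≤ 1) (φ : 𝓢(SpaceTime n, ℂ)) :
    MemLp (fun p => weight p ^ (s / 2) • φ p) 2 := by
  have hc := φ.continuous
  have hw := continuous_weight_rpow (n := n) (s / 2)
  rw [memLp_two_iff_integrable_sq_norm (by fun_prop)]
  simp only [norm_weight_rpow_smul_sq]
  exact integrable_weight_rpow hs φ

/-- Multiplication of Schwartz functions by the square root of a weight, as a map to `L²`. -/
noncomputable def weightedToLp {s : ℝ} (hs : s ≤ 1) :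
    𝓢(SpaceTime n, ℂ) →ₗ[ℂ] Lp ℂ 2 (volume : Measure (SpaceTime n)) where
  toFun φ := (memLp_weight_rpow_smul hs φ).toLp _
  map_add' φ ψ := by
    rw [← MemLp.toLp_add]
    congr 1
    funext p
    simp
  map_smul' c φ := by
    rw [RingHom.id_apply, ← MemLp.toLp_const_smul]
    congr 1
    funext p
    simp [mul_left_comm]

theorem norm_Lp_two_eq {X : Type*} [MeasurableSpace X] {μ : Measure X} (h : Lp ℂ 2 μ) :
    ‖h‖ = (∫ x, ‖h x‖ ^ 2 ∂μ) ^ (1 / 2 : ℝ) := by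
  have := MeasureTheory.L2.inner_def (𝕜 := ℂ) h h
  rw [inner_self_eq_norm_sq_to_K] at this
  simp only [inner_self_eq_norm_sq_to_K] at this
  have h2 : ‖h‖ ^ 2 = ∫ x, ‖h x‖ ^ 2 ∂μ := by
    apply Complex.ofReal_injective
    rw [← integral_complex_ofReal]
    simpa using this
  rw [← h2, ← Real.sqrt_eq_rpow, Real.sqrt_sq (norm_nonneg _)]

theorem norm_weightedToLp {s : ℝ} (hs : s ≤ 1) (φ : 𝓢(SpaceTime n, ℂ)) :
    ‖weightedToLp hs φ‖ = weightedNorm s φ := by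
  rw [norm_Lp_two_eq, weightedNorm]
  congr 1
  refine integral_congr_ae ?_
  filter_upwards [(memLp_weight_rpow_smul hs φ).coeFn_toLp] with p hp
  change ‖(memLp_weight_rpow_smul hs φ).toLp _ p‖ ^ 2 = _
  rw [hp, norm_weight_rpow_smul_sq]

/-- A tempered distribution bounded in the dual weighted norm is a weighted `L²` function. -/
theorem exists_isWeightedL2 {δ : ℝ} (hδ : -1 ≤ δ) (u : 𝓢'(SpaceTime n, ℂ)) {K : ℝ} (hK : 0 ≤ K)
    (h : ∀ φ : 𝓢(SpaceTime n, ℂ), ‖u φ‖ ≤ K * weightedNorm (-δ) φ) :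
    ∃ f : SpaceTime n → ℂ, IsWeightedL2 δ u f ∧ weightedNorm δ f ≤ K := by
  have hs : -δ ≤ 1 := by linarith
  set T : 𝓢(SpaceTime n, ℂ) →ₗ[ℂ] ℂ :=
    { toFun := fun φ => u φ
      map_add' := fun φ ψ => map_add u φ ψ
      map_smul' := fun c φ => map_smul u c φ } with hT
  obtain ⟨v, hvK, hv⟩ := exists_inner_eq_of_norm_le (weightedToLp hs) T hK fun φ => by
    rw [norm_weightedToLp]
    exact h φ
  have hvm := Lp.aestronglyMeasurable v
  have hw := (continuous_weight_rpow (n := n) (-δ / 2)).aestronglyMeasurable (μ := volume)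
  have hnorm (p : SpaceTime n) :
      ‖weight p ^ (-δ / 2) • starRingEnd ℂ (v p)‖ ^ 2 * weight p ^ δ = ‖v p‖ ^ 2 := by
    rw [norm_weight_rpow_smul_sq, mul_assoc, ← Real.rpow_add (weight_pos p), neg_add_cancel,
      Real.rpow_zero, mul_one, RCLike.norm_conj]
  -- The conjugate appears because the inner product is antilinear in its first slot; the power of
  -- the weight makes |f|² weight^δ equal to |v|².
  refine ⟨fun p => weight p ^ (-δ / 2) • starRingEnd ℂ (v p), ⟨?_, ?_, fun φ => ?_⟩, ?_⟩
  · exact hw.smul (continuous_star.comp_aestronglyMeasurable hvm)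
  · simp only [hnorm]
    exact (memLp_two_iff_integrable_sq_norm hvm).1 (Lp.memLp v)
  · refine (hv φ).trans ?_
    rw [L2.inner_def]
    refine integral_congr_ae ?_
    filter_upwards [(memLp_weight_rpow_smul hs φ).coeFn_toLp] with p hp
    change inner ℂ (v p) ((memLp_weight_rpow_smul hs φ).toLp _ p) = _
    rw [hp, RCLike.inner_apply]
    simp only [Complex.real_smul]
    ring
  · rw [weightedNorm]
    simp only [hnorm]
    rw [← norm_Lp_two_eq]
    exact hvK

/-! ### Derivatives and convolution on the Fourier side -/

theorem norm_fourierInv_neg_lineDeriv (φ : 𝓢(SpaceTime n, ℂ)) (e k : SpaceTime n) :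
    ‖𝓕⁻ (-∂_{e} φ) k‖ = |2 * Real.pi * inner ℝ k e| * ‖𝓕⁻ φ k‖ := by
  have hg : (fun k : SpaceTime n => inner ℝ k e).HasTemperateGrowth := by fun_prop
  rw [FourierTransform.fourierInv_neg, fourierInv_lineDerivOp_eq]
  simp only [neg_smul, neg_neg, smul_apply, smulLeftCLM_apply_apply hg]
  rw [norm_smul, norm_smul, abs_mul, ← mul_assoc]
  simp [abs_of_pos Real.pi_pos]

theorem exists_iterate_lineDeriv_apply (e : SpaceTime n) (N : ℕ) (u : 𝓢'(SpaceTime n, ℂ))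
    (φ : 𝓢(SpaceTime n, ℂ)) : ∃ ψ : 𝓢(SpaceTime n, ℂ), ((fun w => ∂_{e} w)^[N] u) φ = u ψ ∧
      ∀ k, ‖𝓕⁻ ψ k‖ = |2 * Real.pi * inner ℝ k e| ^ N * ‖𝓕⁻ φ k‖ := by
  induction N generalizing u with
  | zero => exact ⟨φ, rfl, fun k => by simp⟩
  | succ N ih =>
    obtain ⟨ψ, h1, h2⟩ := ih (∂_{e} u)
    refine ⟨-∂_{e} ψ, ?_, fun k => ?_⟩
    · rw [Function.iterate_succ_apply, h1]
      rfl
    · rw [norm_fourierInv_neg_lineDeriv, h2]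
      ring

theorem exists_foldr_lineDeriv_apply (α : Fin n → ℕ) (l : List (Fin n))
    (u : 𝓢'(SpaceTime n, ℂ)) (φ : 𝓢(SpaceTime n, ℂ)) : ∃ ψ : 𝓢(SpaceTime n, ℂ),
      (l.foldr (fun j v => (fun w => ∂_{spaceDir j} w)^[α j] v) u) φ = u ψ ∧
      ∀ k, ‖𝓕⁻ ψ k‖ ≤ ‖((2 * Real.pi) • k).fst‖ ^ (l.map α).sum * ‖𝓕⁻ φ k‖ := by
  induction l generalizing φ with
  | nil => exact ⟨φ, rfl, fun k => by simp⟩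
  | cons j l ih =>
    obtain ⟨χ, h1, h2⟩ := exists_iterate_lineDeriv_apply (spaceDir j) (α j)
      (l.foldr (fun j v => (fun w => ∂_{spaceDir j} w)^[α j] v) u) φ
    obtain ⟨ψ, h3, h4⟩ := ih χ
    refine ⟨ψ, h1.trans h3, fun k => (h4 k).trans ?_⟩
    rw [h2, List.map_cons, List.sum_cons, pow_add, inner_spaceDir, ← mul_assoc,
      mul_comm (_ ^ _) (_ ^ _)]
    gcongr
    have := PiLp.norm_apply_le ((2 * Real.pi) • k).fst j
    simpa using this

/-- Derivatives are moved onto the test function. Only the modulus of the resulting multiplier is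
recorded, with each |ξ_j| replaced by |ξ|, since the bilinear estimate is absolute. -/
theorem exists_mixedDeriv_apply (α : Fin n → ℕ) (β : ℕ) (u : 𝓢'(SpaceTime n, ℂ))
    (φ : 𝓢(SpaceTime n, ℂ)) : ∃ ψ : 𝓢(SpaceTime n, ℂ), mixedDeriv α β u φ = u ψ ∧
      ∀ k, ‖𝓕⁻ ψ k‖ ≤ ‖((2 * Real.pi) • k).fst‖ ^ (∑ j, α j) *
        |((2 * Real.pi) • k).snd| ^ β * ‖𝓕⁻ φ k‖ := by
  obtain ⟨χ, h1, h2⟩ := exists_foldr_lineDeriv_apply α (List.finRange n)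
    ((fun w => ∂_{timeDir n} w)^[β] u) φ
  obtain ⟨ψ, h3, h4⟩ := exists_iterate_lineDeriv_apply (timeDir n) β u χ
  refine ⟨ψ, h1.trans h3, fun k => ?_⟩
  rw [h4, inner_timeDir, Fin.sum_univ_def, WithLp.smul_snd, smul_eq_mul]
  refine (mul_le_mul_of_nonneg_left (h2 k) (by positivity)).trans_eq ?_
  ring

/-- By definition G_z is tested on ǧ * φ, hence 1/P on 𝓕⁻(ǧ * φ) = 𝓕⁻ǧ · 𝓕⁻φ, and 𝓕⁻ǧ = 𝓕g. -/
theorem distConv_fundSol_apply {z : Fin n → ℂ} (hz : (fun j => (z j).im) ≠ 0)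
    (g φ : 𝓢(SpaceTime n, ℂ)) : distConv (fundSol z hz) g φ =
      ∫ k, 1 / symbolP z ((2 * Real.pi) • k) * (𝓕 g k * 𝓕⁻ φ k) := by
  set g' := compCLMOfContinuousLinearEquiv ℂ (ContinuousLinearEquiv.neg ℝ) g with hg'
  have h1 : distConv (fundSol z hz) g φ =
      ∫ k, 1 / symbolP z ((2 * Real.pi) • k) *
        𝓕⁻ (SchwartzMap.convolution (ContinuousLinearMap.mul ℂ ℂ) g' φ) k := rfl
  rw [h1]
  refine integral_congr_ae (Filter.Eventually.of_forall fun k => ?_)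
  have h2 : 𝓕⁻ (SchwartzMap.convolution (ContinuousLinearMap.mul ℂ ℂ) g' φ) k =
      𝓕⁻ g' k * 𝓕⁻ φ k := by
    rw [fourierInv_apply_eq, fourier_convolution, fourierInv_apply_eq, fourierInv_apply_eq]
    rfl
  have h3 : 𝓕⁻ g' = 𝓕 g := by
    rw [fourierInv_eq_fourier_compNeg]
    congr 1
    ext p
    simp [hg']
  simp only [h2, h3]

end SpaceTime

/-! ### Conclusion -/

theorem proposition3p1 (n : ℕ) (δ : ℝ) (hδ : -1 < δ) (hδ0 : δ < 0) :
    ∃ C : ℝ, 0 < C ∧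
      ∀ (R : ℝ) (hR : 0 < R) (τ : ℝ) (hτ : R ≤ τ)
        (ω : EuclideanSpace ℝ (Fin n)) (hω : ‖ω‖ = 1)
        (g : 𝓢(SpaceTime n, ℂ)) (α : Fin n → ℕ) (β : ℕ), (∑ j, α j) + 2 * β ≤ 2 →
        ∃ f : SpaceTime n → ℂ,
          IsWeightedL2 δ (mixedDeriv α β
            (distConv (fundSol (imVec τ ω) (imVec_im_ne_zero (hR.trans_le hτ) hω)) g)) f ∧
          weightedNorm δ f ≤
            C * τ ^ ((∑ j, α j) + 2 * β) / scaleConst R ^ (1 / 2 : ℝ) *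
              weightedNorm (1 + δ) (g : SpaceTime n → ℂ) := by
  obtain ⟨C, hC, hCb⟩ := exists_lintegral_bilinear_le n (s := 1 + δ) (by linarith) (by linarith)
  refine ⟨C, hC, fun R hR τ hτ ω hω g α β hαβ => ?_⟩
  have hτ0 : 0 < τ := hR.trans_le hτ
  have hS : 0 < scaleConst R := by
    unfold scaleConst
    positivity
  -- The bilinear estimate is used with m = q⁻¹. The entries 1, R² and R⁴ of the minimum give m ≥ 1,
  -- mτ ≥ 1 and mτ² ≥ 1 respectively.
  set q := scaleConst R ^ (1 / 2 : ℝ) with hq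
  have hq0 : 0 < q := Real.rpow_pos_of_pos hS _
  have hqle {x : ℝ} (hx : 0 ≤ x) (h : scaleConst R ≤ x ^ 2) : q ≤ x := by
    rw [hq, ← Real.sqrt_eq_rpow]
    exact Real.sqrt_le_iff.2 ⟨hx, h⟩
  have hq1 : q ≤ 1 := hqle zero_le_one (by
    rw [one_pow]
    exact (min_le_right _ _).trans (min_le_right _ _))
  have hqτ : q ≤ τ := (hqle hR.le ((min_le_right _ _).trans (min_le_left _ _))).trans hτ
  have hqτ2 : q ≤ τ ^ 2 := by
    refine (hqle (x := R ^ 2) (by positivity) ?_).trans (by gcongr)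
    rw [← pow_mul]
    exact min_le_left _ _
  have hN0 {s : ℝ} (f : SpaceTime n → ℂ) : 0 ≤ weightedNorm s f :=
    Real.rpow_nonneg (integral_nonneg fun p =>
      mul_nonneg (by positivity) (Real.rpow_nonneg (weight_pos p).le _)) _
  refine exists_isWeightedL2 hδ.le _ (mul_nonneg (by positivity) (hN0 _)) fun φ => ?_
  obtain ⟨ψ, hψ, hψb⟩ := exists_mixedDeriv_apply α β
    (distConv (fundSol (imVec τ ω) (imVec_im_ne_zero (hR.trans_le hτ) hω)) g) φ
  rw [hψ, distConv_fundSol_apply]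
  have hb := hCb τ q⁻¹ ω (∑ j, α j) β hτ0 ((one_le_inv₀ hq0).2 hq1)
    (by rw [inv_mul_eq_div, one_le_div hq0]; exact hqτ)
    (by rw [inv_mul_eq_div, one_le_div hq0]; exact hqτ2) hω hαβ g φ
  have e : 1 - (1 + δ) = -δ := by ring
  rw [e, weightedENorm_eq_ofReal (integrable_weight_rpow (by linarith) g),
    weightedENorm_eq_ofReal (integrable_weight_rpow (by linarith) φ),
    ← ENNReal.ofReal_mul (hN0 _), ← ENNReal.ofReal_mul (by positivity), ← mul_assoc,
    ← div_eq_mul_inv] at hb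
  rw [← ENNReal.ofReal_le_ofReal_iff (mul_nonneg (mul_nonneg (by positivity) (hN0 _)) (hN0 _)),
    ofReal_norm]
  refine (enorm_integral_le_lintegral_enorm _).trans (le_trans (lintegral_mono fun k => ?_) hb)
  rw [enorm_mul, enorm_mul, mul_assoc]
  refine mul_le_mul' le_rfl ?_
  rw [mul_left_comm]
  refine mul_le_mul' le_rfl ?_
  rw [← ofReal_norm, ← ofReal_norm, ← ENNReal.ofReal_mul (by positivity)]
  exact ENNReal.ofReal_le_ofReal (hψb k)
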